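/- Let $\mathbb{T}=\mathbb{R}/\mathbb{Z}$ be the circle with its usual quotient distance $d$, let $K\subset\mathbb{T}$ be the image modulo one of the middle-third Cantor set, and let $\kappa=\log 2/\log 3$. Let $\mathcal{P}$ be the set of all pairs $(p,q)$ of integers with $0\le p<q$ and $\gcd(p,q)=1$, and for $j\ge 0$ let $\mathcal{P}^{j}$ be the set of pairs $(p,q)\in\mathcal{P}$ with $3^{j}\le q<3^{j+1}$. Let $\mathcal{P}_K\subseteq\mathcal{P}$ be a subset with \[ \sigma(\mathcal{P}_K):=\limsup_{j\to\infty}\frac1j\log_3\#(\mathcal{P}_K\cap\mathcal{P}^{j})=\kappa . \] Let $(Y_{p,q})_{(p,q)\in\mathcal{P}}$ be independent random variables with values in $\mathbb{T}$, defined on a common probability space, such that $Y_{p,q}$ is uniformly distributed in $K$ if $(p,q)\in\mathcal{P}_K$ (its law is the normalized restriction to $K$ of the $\kappa$-dimensional Hausdorff measure), and $Y_{p,q}$ is distributed according to the Lebesgue measure on $\mathbb{T}$ if $(p,q)\notin\mathcal{P}_K$. For $\mu\ge 0$ let \[ \mathcal{F}(\mu)=\left\{\xi\in\mathbb{T} :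 d(\xi,Y_{p,q})<q^{-\mu}\ \text{for infinitely many } (p,q)\in\mathcal{P}\right\}, \] and for $\xi\in\mathbb{T}$ let $\mu^{\bullet}(\xi)=\sup\{\mu\ge 0 : \xi\in\mathcal{F}(\mu)\}\in[0,\infty]$. For $\mu\geq 0$ let $\mathcal{M}^{\bullet}(\mu)=\{\xi\in\mathbb{T} : \mu^{\bullet}(\xi)\ge\mu\}$. Then, with probability one, both of the following hold: 1. for every point $\xi\in K$, $\mu^{\bullet}(\xi)\ge 2$; 2. for every real number $\mu\ge 2$, \[ \dim_{\mathrm H}(\mathcal{M}^{\bullet}(\mu)\cap K)=\max\left\{\frac{2}{\mu}+\kappa-1,\ \frac{\kappa}{\mu}\right\}. \] -/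

import Mathlib

open MeasureTheory ProbabilityTheory Filter
open scoped ENNReal MeasureTheory

noncomputable section

namespace CantorApprox

/-- The collection of all pairs `(p, q)` of integers with `0 ≤ p < q` and `gcd (p, q) = 1`:
every rational point of the circle `ℝ / ℤ` is `p / q` for exactly one such pair. -/
def ReducedPair : Type := {x : ℕ × ℕ // x.1 < x.2 ∧ Nat.Coprime x.1 x.2}

/-- The denominator `q` of a pair `(p, q)`. -/
def ReducedPair.den (x : ReducedPair) : ℕ := x.val.2

/-- The pairs `(p, q)` with `3 ^ j ≤ q < 3 ^ (j + 1)`. -/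
def block (j : ℕ) : Set ReducedPair := {x | 3 ^ j ≤ x.den ∧ x.den < 3 ^ (j + 1)}

/-- The density `σ(S) = limsup_j (1 / j) log₃ #(S ∩ block j)` of a set `S` of pairs, as an
extended real number (with `log 0 = -∞`). -/
def density (S : Set ReducedPair) : EReal :=
  limsup (fun j : ℕ =>
    ENNReal.log ((S ∩ block j).ncard : ℝ≥0∞) / (((j : ℝ) * Real.log 3 : ℝ) : EReal)) atTop

/-- The number `κ = log 2 / log 3`, the Hausdorff dimension of the middle-third Cantor set. -/
def kappa : ℝ := Real.log 2 / Real.log 3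

/-- The image of the middle-third Cantor set in the circle `ℝ / ℤ`. -/
def cantorCircle : Set UnitAddCircle := (fun x : ℝ => (x : UnitAddCircle)) '' cantorSet

/-- The family `Y` consists of independent random points of the circle; `Y x` is uniform on the
Cantor set (its law is the normalized restriction to the Cantor set of the `κ`-dimensional
Hausdorff measure) if `x ∈ PK`, and uniform on the circle (its law is Lebesgue measure)
otherwise. -/
structure IsRandomModel {Ω : Type*} [MeasurableSpace Ω] (P : Measure Ω)
    (PK : Set ReducedPair) (Y : ReducedPair → Ω → UnitAddCircle) : Prop where
  measurable : ∀ x, Measurable (Y x)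
  indep : iIndepFun Y P
  law_cantor : ∀ x ∈ PK,
    P.map (Y x) = (μH[kappa] cantorCircle)⁻¹ • (μH[kappa]).restrict cantorCircle
  law_circle : ∀ x ∉ PK, P.map (Y x) = volume

/-- The set `F(μ)` of the points `ξ` of the circle such that `d(ξ, y_{p,q}) < q ^ (-μ)` for
infinitely many pairs `(p, q)`. -/
def approxSet (y : ReducedPair → UnitAddCircle) (μ : ℝ) : Set UnitAddCircle :=
  {ξ | {x : ReducedPair | dist ξ (y x) < (x.den : ℝ) ^ (-μ)}.Infinite}

/-- The exponent `sup {μ ≥ 0 | ξ ∈ F(μ)}`, which may be `+∞`. -/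
def exponent (y : ReducedPair → UnitAddCircle) (ξ : UnitAddCircle) : EReal :=
  sSup ((fun μ : ℝ => (μ : EReal)) '' {μ : ℝ | 0 ≤ μ ∧ ξ ∈ approxSet y μ})

/-- The set of the points of the circle whose exponent is at least `μ`. -/
def exponentSet (y : ReducedPair → UnitAddCircle) (μ : ℝ) : Set UnitAddCircle :=
  {ξ | (μ : EReal) ≤ exponent y ξ}

end CantorApprox

end

/-!
The `j`-th block consists of about `9 ^ j` pairs. The question is how many of their balls
`B (Y x, q ^ (-μ))` meet the Cantor set `K`, and where.

*Coding.* Points of `K` are coded by binary sequences; the first `m` digits determine a basic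
interval of length `3 ^ (-m)`, and all the parts of `K` that belong to words of the same length are
translates of each other. By invariance and subadditivity each of them has at least its share of
the mass, both for the Hausdorff measure (`hausdorffMeasure_cylinder_ge`) and for the Lebesgue
measure of the `m`-th step of the construction of `K` (`volume_hull_ge`). That the normalized
Hausdorff measure is a probability measure is part of the hypothesis on the laws, so its total mass
cancels.

*Upper bound.* The balls with centres in `K`, about `3 ^ (κ j)` in the `j`-th block, have a finite
sum of `s`-th powers of radii if `s > κ / μ`. A ball with a uniform centre meets `K` with
probability at most `8 q ^ (-μ (1 - κ))` (`volume_thickening_cantorCircle_le`), and there are at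
most `9 ^ (j + 1)` of them, so the expected sum over those that meet `K` is finite if
`s > 2 / μ + κ - 1`. All these balls cover the points of `K` in question infinitely often
(`dimH_limsup_le`).

*Lower bound.* Let `m ≈ μ j` and `n ≈ θ m`. If the expected number of points `Y x` of the `j`-th
block in the basic intervals of level `m` that lie in a given one of level `n` grows exponentially,
then by Borel–Cantelli almost surely all words of length `n` can be continued to a word of length
`m` whose basic interval contains such a point (`ae_eventually_hits`). For the points with uniform
law this happens for `κ θ < 2 / μ + κ - 1` and all large `j`, for those in `K` it happens for
`θ < 1 / μ` and infinitely many `j`. Given such continuations, let `u` be a binary sequence and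
overwrite its digits in a sparse sequence of windows `[n k, m k)` by the digits of the
continuations. The resulting points of `K` lie in the set of approximable points, and the digits
outside of the windows, read in base `2`, map them onto `[0, 1]` by a map that is Hölder continuous
of exponent `κ θ`, since the positions outside of the windows have lower density `θ`. Therefore the
dimension is at least `κ θ` (`le_dimH_approxSet_inter`).

For `μ < 2` the value `θ = 1` is admissible, which means that every basic interval of level `m`
contains a point of the `j`-th block: this is the Dirichlet-type statement that all exponents are
at least `2` (`ae_cantorCircle_subset_approxSet`).
-/

noncomputable section

namespace CantorApprox

open Set Metric
open scoped NNReal Topology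

/-! ### Coding of the Cantor set by binary sequences -/

/-- The ternary digits, all equal to `0` or `2`, that a binary sequence encodes. -/
def ternary (b : ℕ → Bool) : ℕ → Fin 3 := fun i => cond (b i) 2 0

/-- The point of the Cantor set (as a real number) with the given code. -/
def codePoint (b : ℕ → Bool) : ℝ := Real.ofDigits (ternary b)

/-- The left end point of the basic interval of level `n` that contains `codePoint b`. -/
def leftEnd (b : ℕ → Bool) (n : ℕ) : ℝ := ∑ i ∈ Finset.range n, Real.ofDigitsTerm (ternary b) i

/-- The basic interval of level `m` that contains `codePoint b`, seen on the circle. -/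
def arc (b : ℕ → Bool) (m : ℕ) : Set UnitAddCircle :=
  (fun x : ℝ => (x : UnitAddCircle)) '' Icc (leftEnd b m) (leftEnd b m + (3 ^ m : ℝ)⁻¹)

/-- The binary sequences with the same first `n` terms as `b`. -/
def agree (b : ℕ → Bool) (n : ℕ) : Set (ℕ → Bool) := {v | ∀ i < n, v i = b i}

/-- The union of the basic intervals of level `m` that are indexed by the extensions of the
first `n` terms of `b`. -/
def hull (b : ℕ → Bool) (n m : ℕ) : Set UnitAddCircle := ⋃ v ∈ agree b n, arc v m

/-- The part of the Cantor set in the basic interval of level `n` that contains `codePoint b`. -/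
def cylinder (b : ℕ → Bool) (n : ℕ) : Set UnitAddCircle :=
  (fun v => (codePoint v : UnitAddCircle)) '' agree b n

/-- A finite word, continued by zeros. -/
def pad {n : ℕ} (w : Fin n → Bool) : ℕ → Bool := fun i => if h : i < n then w ⟨i, h⟩ else false

/-- A binary sequence whose first `n` terms are replaced by zeros. -/
def zeroed (n : ℕ) (v : ℕ → Bool) : ℕ → Bool := fun i => if i < n then false else v i

lemma pad_restrict_mem_agree (b : ℕ → Bool) (n : ℕ) :
    pad (fun i : Fin n => b i) ∈ agree b n := by
  intro i hi
  simp [pad, hi]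

lemma agree_eq_of_mem {b v : ℕ → Bool} {n : ℕ} (h : v ∈ agree b n) : agree v n = agree b n := by
  ext u
  exact ⟨fun hu i hi => (hu i hi).trans (h i hi), fun hu i hi => (hu i hi).trans (h i hi).symm⟩

lemma cantorSet_eq_range_codePoint : cantorSet = range codePoint := by
  ext x
  constructor
  · intro hx
    refine ⟨cantorSetEquivNatToBool ⟨x, hx⟩, ?_⟩
    exact congrArg Subtype.val (cantorSetEquivNatToBool.symm_apply_apply ⟨x, hx⟩)
  · rintro ⟨b, rfl⟩
    exact ofDigits_bool_to_fin_three_mem_cantorSet b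

lemma cantorCircle_eq_range : cantorCircle = range (fun b => (codePoint b : UnitAddCircle)) := by
  rw [cantorCircle, cantorSet_eq_range_codePoint, ← range_comp]
  rfl

lemma isCompact_cantorCircle : IsCompact cantorCircle :=
  isCompact_cantorSet.image (AddCircle.continuous_mk' 1)

lemma codePoint_mem_Icc (b : ℕ → Bool) (m : ℕ) :
    codePoint b ∈ Icc (leftEnd b m) (leftEnd b m + (3 ^ m : ℝ)⁻¹) := by
  have h := Real.ofDigits_eq_sum_add_ofDigits (ternary b) m
  have h0 := Real.ofDigits_nonneg (fun i => ternary b (i + m))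
  have h1 := Real.ofDigits_le_one (fun i => ternary b (i + m))
  have h3 : (0 : ℝ) < (3 ^ m : ℝ)⁻¹ := by positivity
  rw [codePoint, h, leftEnd]
  push_cast
  constructor
  · nlinarith
  · nlinarith

lemma codePoint_mem_arc (b : ℕ → Bool) (m : ℕ) : (codePoint b : UnitAddCircle) ∈ arc b m :=
  mem_image_of_mem _ (codePoint_mem_Icc b m)

lemma dist_coe_le (x y : ℝ) : dist (x : UnitAddCircle) (y : UnitAddCircle) ≤ |x - y| := by
  rw [dist_eq_norm, ← AddCircle.coe_sub]
  exact QuotientAddGroup.norm_mk_le_norm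

lemma dist_le_of_mem_arc {b : ℕ → Bool} {m : ℕ} {x y : UnitAddCircle} (hx : x ∈ arc b m)
    (hy : y ∈ arc b m) : dist x y ≤ (3 ^ m : ℝ)⁻¹ := by
  obtain ⟨s, hs, rfl⟩ := hx
  obtain ⟨t, ht, rfl⟩ := hy
  refine (dist_coe_le s t).trans ?_
  rw [abs_le]
  constructor <;> linarith [hs.1, hs.2, ht.1, ht.2]

lemma leftEnd_congr {b v : ℕ → Bool} {n : ℕ} (h : v ∈ agree b n) : leftEnd v n = leftEnd b n := by
  refine Finset.sum_congr rfl fun i hi => ?_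
  simp [Real.ofDigitsTerm, ternary, h i (Finset.mem_range.1 hi)]

lemma arc_congr {b v : ℕ → Bool} {n : ℕ} (h : v ∈ agree b n) : arc v n = arc b n := by
  rw [arc, arc, leftEnd_congr h]

/-- There are only finitely many basic intervals of a given level. -/
lemma measurableSet_hull (b : ℕ → Bool) (n m : ℕ) : MeasurableSet (hull b n m) := by
  have hfin : (range fun v : ℕ → Bool => arc v m).Finite := by
    refine (finite_range fun w : Fin m → Bool => arc (pad w) m).subset ?_
    rintro _ ⟨v, rfl⟩
    exact ⟨fun i => v i, arc_congr (pad_restrict_mem_agree v m)⟩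
  rw [hull, ← sUnion_image]
  refine (hfin.subset (image_subset_range _ _)).measurableSet_sUnion ?_
  rintro _ ⟨v, -, rfl⟩
  exact (isCompact_Icc.image (AddCircle.continuous_mk' 1)).measurableSet

lemma cylinder_subset_hull (b : ℕ → Bool) (n m : ℕ) : cylinder b n ⊆ hull b n m := by
  rintro _ ⟨v, hv, rfl⟩
  exact mem_iUnion₂.2 ⟨v, hv, codePoint_mem_arc v m⟩

lemma cylinder_subset_cantorCircle (b : ℕ → Bool) (n : ℕ) : cylinder b n ⊆ cantorCircle := by
  rw [cantorCircle_eq_range]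
  exact image_subset_range _ _

/-! ### Translations between cylinders of the same level -/

lemma zeroed_mem_agree (n : ℕ) (v : ℕ → Bool) : zeroed n v ∈ agree (fun _ => false) n := by
  intro i hi
  simp [zeroed, hi]

lemma ofDigitsTerm_zeroed (n : ℕ) (v : ℕ → Bool) (i : ℕ) :
    Real.ofDigitsTerm (ternary v) i =
      (if i < n then Real.ofDigitsTerm (ternary v) i else 0) +
        Real.ofDigitsTerm (ternary (zeroed n v)) i := by
  by_cases hi : i < n <;> simp [hi, Real.ofDigitsTerm, ternary, zeroed]

lemma leftEnd_eq_add_zeroed {n m : ℕ} (hnm : n ≤ m) (v : ℕ → Bool) :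
    leftEnd v m = leftEnd v n + leftEnd (zeroed n v) m := by
  have : leftEnd v n = ∑ i ∈ Finset.range m,
      if i < n then Real.ofDigitsTerm (ternary v) i else 0 := by
    rw [← Finset.sum_filter]
    refine Finset.sum_congr ?_ fun _ _ => rfl
    ext i
    simp only [Finset.mem_range, Finset.mem_filter]
    omega
  rw [this, leftEnd, leftEnd, ← Finset.sum_add_distrib]
  exact Finset.sum_congr rfl fun i _ => ofDigitsTerm_zeroed n v i

lemma codePoint_eq_add_zeroed (n : ℕ) (v : ℕ → Bool) :
    codePoint v = leftEnd v n + codePoint (zeroed n v) := by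
  have h1 := Real.ofDigits_eq_sum_add_ofDigits (ternary v) n
  have h2 := Real.ofDigits_eq_sum_add_ofDigits (ternary (zeroed n v)) n
  have h3 : ∑ i ∈ Finset.range n, Real.ofDigitsTerm (ternary (zeroed n v)) i = 0 := by
    refine Finset.sum_eq_zero fun i hi => ?_
    simp [Real.ofDigitsTerm, ternary, zeroed, Finset.mem_range.1 hi]
  have h4 : (fun i => ternary (zeroed n v) (i + n)) = fun i => ternary v (i + n) := by
    ext i
    simp [ternary, zeroed]
  rw [codePoint, codePoint, h1, h2, h3, h4, leftEnd, zero_add]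

/-- The sequence that starts as `b` and continues as `v`. -/
def splice (n : ℕ) (b v : ℕ → Bool) : ℕ → Bool := fun i => if i < n then b i else v i

lemma splice_mem_agree (n : ℕ) (b v : ℕ → Bool) : splice n b v ∈ agree b n := by
  intro i hi
  simp [splice, hi]

lemma zeroed_splice {n : ℕ} {b v : ℕ → Bool} (hv : v ∈ agree (fun _ => false) n) :
    zeroed n (splice n b v) = v := by
  ext i
  by_cases hi : i < n
  · simp [zeroed, hi, hv i hi]
  · simp [zeroed, splice, hi]

lemma hull_eq_preimage {n m : ℕ} (hnm : n ≤ m) (b : ℕ → Bool) :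
    hull (fun _ => false) n m =
      (fun y => (leftEnd b n : UnitAddCircle) + y) ⁻¹' hull b n m := by
  have harc : ∀ v ∈ agree b n, arc v m =
      (fun y => (leftEnd b n : UnitAddCircle) + y) '' arc (zeroed n v) m := by
    intro v hv
    rw [arc, arc, ← image_comp, leftEnd_eq_add_zeroed hnm v, leftEnd_congr hv]
    ext y
    constructor
    · rintro ⟨t, ht, rfl⟩
      refine ⟨t - leftEnd b n, ⟨by linarith [ht.1], by linarith [ht.2]⟩, ?_⟩
      simp
    · rintro ⟨t, ht, rfl⟩
      refine ⟨leftEnd b n + t, ⟨by linarith [ht.1], by linarith [ht.2]⟩, ?_⟩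
      simp
  ext y
  simp only [hull, mem_iUnion, mem_preimage, exists_prop]
  constructor
  · rintro ⟨v, hv, hy⟩
    refine ⟨splice n b v, splice_mem_agree n b v, ?_⟩
    rw [harc _ (splice_mem_agree n b v), zeroed_splice hv]
    exact mem_image_of_mem _ hy
  · rintro ⟨v, hv, hy⟩
    refine ⟨zeroed n v, zeroed_mem_agree n v, ?_⟩
    rw [harc v hv] at hy
    obtain ⟨z, hz, hzy⟩ := hy
    rwa [← add_left_cancel hzy]

lemma cylinder_eq_image (b : ℕ → Bool) (n : ℕ) :
    cylinder b n = (fun y => (leftEnd b n : UnitAddCircle) + y) '' cylinder (fun _ => false) n := by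
  ext y
  constructor
  · rintro ⟨v, hv, rfl⟩
    refine ⟨_, ⟨zeroed n v, zeroed_mem_agree n v, rfl⟩, ?_⟩
    simp only
    rw [codePoint_eq_add_zeroed n v, leftEnd_congr hv, AddCircle.coe_add]
  · rintro ⟨_, ⟨v, hv, rfl⟩, rfl⟩
    refine ⟨splice n b v, splice_mem_agree n b v, ?_⟩
    simp only
    rw [codePoint_eq_add_zeroed n (splice n b v), leftEnd_congr (splice_mem_agree n b v),
      zeroed_splice hv, AddCircle.coe_add]

lemma kappa_pos : 0 < kappa := div_pos (Real.log_pos (by norm_num)) (Real.log_pos (by norm_num))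

lemma kappa_lt_one : kappa < 1 := by
  rw [kappa, div_lt_one (Real.log_pos (by norm_num))]
  exact Real.log_lt_log (by norm_num) (by norm_num)

lemma three_rpow_kappa : (3 : ℝ) ^ kappa = 2 := by
  rw [kappa, Real.rpow_def_of_pos (by norm_num), mul_div_cancel₀ _
    (Real.log_pos (by norm_num)).ne', Real.exp_log (by norm_num)]

/-- Each of the `2 ^ n` cylinders of level `n` carries the fraction `2 ^ (-n)` of the mass of the
Cantor set, because they are translates of each other. -/
lemma hausdorffMeasure_cylinder_ge (b : ℕ → Bool) (n : ℕ) :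
    μH[kappa] cantorCircle ≤ 2 ^ n * μH[kappa] (cylinder b n) := by
  have heq : ∀ v : ℕ → Bool,
      μH[kappa] (cylinder v n) = μH[kappa] (cylinder (fun _ => false) n) := by
    intro v
    rw [cylinder_eq_image]
    exact (isometry_add_left _).hausdorffMeasure_image (Or.inl kappa_pos.le) _
  have hsub : cantorCircle ⊆ ⋃ w : Fin n → Bool, cylinder (pad w) n := by
    rw [cantorCircle_eq_range]
    rintro _ ⟨v, rfl⟩
    refine mem_iUnion.2 ⟨fun i => v i, v, ?_, rfl⟩
    rw [agree_eq_of_mem (pad_restrict_mem_agree v n)]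
    exact fun _ _ => rfl
  calc μH[kappa] cantorCircle ≤ ∑' w : Fin n → Bool, μH[kappa] (cylinder (pad w) n) :=
        (measure_mono hsub).trans (measure_iUnion_le _)
    _ = 2 ^ n * μH[kappa] (cylinder b n) := by
        simp_rw [heq, tsum_fintype]
        simp

/-! ### Lebesgue measure of the neighbourhoods of the Cantor set -/

lemma volume_preCantorSet (m : ℕ) : volume (preCantorSet m) = ENNReal.ofReal ((2 / 3) ^ m) := by
  induction m with
  | zero => simp
  | succ m ih =>
    have hsub := preCantorSet_subset_unitInterval (n := m)
    have h1 : volume ((· / 3) '' preCantorSet m) = ENNReal.ofReal (1 / 3 * (2 / 3) ^ m) := by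
      have : (fun x : ℝ => x / 3) = fun x => (1 / 3 : ℝ) • x := by
        ext x; simp; ring
      rw [this, image_smul, Measure.addHaar_smul, ih, ← ENNReal.ofReal_mul (by positivity)]
      norm_num
    have h2 : (fun x : ℝ => (2 + x) / 3) '' preCantorSet m =
        (fun y => 2 / 3 + y) '' ((· / 3) '' preCantorSet m) := by
      rw [← image_comp]
      refine image_congr' fun x => ?_
      simp only [Function.comp]
      ring
    have h3 : volume ((fun x : ℝ => (2 + x) / 3) '' preCantorSet m) =
        ENNReal.ofReal (1 / 3 * (2 / 3) ^ m) := by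
      rw [h2, image_add_left, measure_preimage_add, h1]
    rw [preCantorSet_succ, measure_union, h1, h3, ← ENNReal.ofReal_add (by positivity)
      (by positivity)]
    · congr 1
      ring
    · rw [Set.disjoint_left]
      rintro _ ⟨x, hx, rfl⟩ ⟨y, hy, hxy⟩
      have := (hsub hx).2
      have := (hsub hy).1
      simp only at hxy
      linarith
    · rw [h2, ← image_comp]
      have hc : IsCompact (preCantorSet m) :=
        isCompact_Icc.of_isClosed_subset (isClosed_preCantorSet m) hsub
      exact (hc.image (by fun_prop)).measurableSet

/-- The sequence with first term `c` that continues as `v`. -/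
def consBit (c : Bool) (v : ℕ → Bool) : ℕ → Bool := fun i => Nat.casesOn i c v

lemma leftEnd_consBit (c : Bool) (v : ℕ → Bool) (m : ℕ) :
    leftEnd (consBit c v) (m + 1) = ((cond c 2 0 : ℝ) + leftEnd v m) / 3 := by
  rw [leftEnd, Finset.sum_range_succ', leftEnd, add_div, Finset.sum_div, add_comm]
  congr 1
  · cases c <;> simp [Real.ofDigitsTerm, ternary, consBit]
    norm_num
  · refine Finset.sum_congr rfl fun i _ => ?_
    simp only [Real.ofDigitsTerm, ternary, consBit]
    push_cast
    rw [pow_succ _ (i + 1)]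
    field_simp

lemma preCantorSet_subset (m : ℕ) :
    preCantorSet m ⊆ ⋃ v : ℕ → Bool, Icc (leftEnd v m) (leftEnd v m + (3 ^ m : ℝ)⁻¹) := by
  induction m with
  | zero =>
    intro x hx
    exact mem_iUnion.2 ⟨fun _ => false, by simpa [leftEnd] using hx⟩
  | succ m ih =>
    have h3 : ((3 : ℝ) ^ (m + 1))⁻¹ = (3 ^ m : ℝ)⁻¹ / 3 := by
      rw [pow_succ, mul_inv, div_eq_mul_inv]
    rintro _ (⟨x, hx, rfl⟩ | ⟨x, hx, rfl⟩)
    · obtain ⟨v, hv⟩ := mem_iUnion.1 (ih hx)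
      refine mem_iUnion.2 ⟨consBit false v, ?_⟩
      rw [leftEnd_consBit, h3]
      constructor <;> simp only [cond_false] <;> linarith [hv.1, hv.2]
    · obtain ⟨v, hv⟩ := mem_iUnion.1 (ih hx)
      refine mem_iUnion.2 ⟨consBit true v, ?_⟩
      rw [leftEnd_consBit, h3]
      constructor <;> simp only [cond_true] <;> linarith [hv.1, hv.2]

/-- The hulls of all words of length `n` are translates of each other, and together they contain
the `m`-th step of the construction of the Cantor set. -/
lemma volume_hull_ge (b : ℕ → Bool) {n m : ℕ} (hnm : n ≤ m) :
    ENNReal.ofReal ((2 / 3) ^ m) ≤ 2 ^ n * volume (hull b n m) := by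
  have heq : ∀ v : ℕ → Bool, volume (hull v n m) = volume (hull (fun _ => false) n m) := by
    intro v
    rw [hull_eq_preimage hnm v, measure_preimage_add]
  set U : Set UnitAddCircle := ⋃ w : Fin n → Bool, hull (pad w) n m with hU
  have hUm : MeasurableSet U := MeasurableSet.iUnion fun w => measurableSet_hull _ n m
  have hsub : preCantorSet m \ {0} ⊆ (fun x : ℝ => (x : UnitAddCircle)) ⁻¹' U ∩ Ioc 0 (0 + 1) := by
    rintro x ⟨hx, hx0⟩
    have hx01 := preCantorSet_subset_unitInterval hx
    refine ⟨?_, lt_of_le_of_ne hx01.1 (Ne.symm hx0), by simpa using hx01.2⟩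
    obtain ⟨v, hv⟩ := mem_iUnion.1 (preCantorSet_subset m hx)
    refine mem_iUnion.2 ⟨fun i => v i, mem_iUnion₂.2 ⟨v, ?_, mem_image_of_mem _ hv⟩⟩
    exact fun i hi => ((pad_restrict_mem_agree v n) i hi).symm
  calc ENNReal.ofReal ((2 / 3) ^ m) = volume (preCantorSet m \ {0}) := by
        rw [measure_sdiff_null (measure_singleton 0), volume_preCantorSet]
    _ ≤ volume U := by
        rw [AddCircle.add_projection_respects_measure 1 0 hUm]
        exact measure_mono hsub
    _ ≤ ∑' w : Fin n → Bool, volume (hull (pad w) n m) := measure_iUnion_le _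
    _ = 2 ^ n * volume (hull b n m) := by
        simp_rw [heq, tsum_fintype]
        simp

lemma cantorCircle_subset_iUnion_ball (m : ℕ) :
    cantorCircle ⊆
      ⋃ w : Fin m → Bool, closedBall (leftEnd (pad w) m : UnitAddCircle) (3 ^ m : ℝ)⁻¹ := by
  rw [cantorCircle_eq_range]
  rintro _ ⟨v, rfl⟩
  refine mem_iUnion.2 ⟨fun i => v i, ?_⟩
  rw [leftEnd_congr (pad_restrict_mem_agree v m)]
  refine dist_le_of_mem_arc (codePoint_mem_arc v m) (mem_image_of_mem _ ⟨le_rfl, ?_⟩)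
  have : (0 : ℝ) < (3 ^ m : ℝ)⁻¹ := by positivity
  linarith

lemma volume_thickening_cantorCircle_le {r : ℝ} (hr : 0 < r) (hr1 : r ≤ 1) :
    volume (thickening r cantorCircle) ≤ ENNReal.ofReal (8 * r ^ (1 - kappa)) := by
  -- `m` is the level at which the basic intervals have length comparable to `r`
  obtain ⟨m, hm1, hm2⟩ : ∃ m : ℕ, (3 ^ m : ℝ)⁻¹ ≤ r ∧ (3 : ℝ) ^ m ≤ 3 * r⁻¹ := by
    obtain ⟨k, hk1, hk2⟩ := exists_nat_pow_near (one_le_inv₀ hr |>.2 hr1) (by norm_num : (1:ℝ) < 3)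
    refine ⟨k + 1, inv_le_of_inv_le₀ hr hk2.le, ?_⟩
    rw [pow_succ]
    linarith
  have h2 : (2 : ℝ) ^ m ≤ 2 * r ^ (-kappa) := by
    have h := Real.rpow_le_rpow (by positivity) hm2 kappa_pos.le
    rw [Real.mul_rpow (by norm_num) (by positivity), three_rpow_kappa, ← Real.rpow_natCast,
      ← Real.rpow_mul (by norm_num), mul_comm (m : ℝ), Real.rpow_mul (by norm_num),
      three_rpow_kappa, Real.rpow_natCast, Real.inv_rpow hr.le, ← Real.rpow_neg hr.le] at h
    exact h
  have hsub : thickening r cantorCircle ⊆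
      ⋃ w : Fin m → Bool, closedBall (leftEnd (pad w) m : UnitAddCircle) (2 * r) := by
    intro y hy
    obtain ⟨z, hz, hyz⟩ := mem_thickening_iff.1 hy
    obtain ⟨w, hw⟩ := mem_iUnion.1 (cantorCircle_subset_iUnion_ball m hz)
    refine mem_iUnion.2 ⟨w, ?_⟩
    have := mem_closedBall.1 hw
    rw [mem_closedBall]
    linarith [dist_triangle y z (leftEnd (pad w) m : UnitAddCircle)]
  calc volume (thickening r cantorCircle)
      ≤ ∑' w : Fin m → Bool, volume (closedBall (leftEnd (pad w) m : UnitAddCircle) (2 * r)) :=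
        (measure_mono hsub).trans (measure_iUnion_le _)
    _ ≤ ∑' w : Fin m → Bool, ENNReal.ofReal (4 * r) := by
        refine ENNReal.tsum_le_tsum fun w => ?_
        rw [AddCircle.volume_closedBall]
        exact ENNReal.ofReal_le_ofReal ((min_le_right _ _).trans (by linarith))
    _ = ENNReal.ofReal (2 ^ m * (4 * r)) := by
        rw [tsum_fintype, ENNReal.ofReal_mul (p := 2 ^ m) (by positivity),
          ENNReal.ofReal_pow (by norm_num)]
        simp
    _ ≤ ENNReal.ofReal (8 * r ^ (1 - kappa)) := by
        refine ENNReal.ofReal_le_ofReal ?_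
        have : r ^ (1 - kappa) = r ^ (-kappa) * r := by
          rw [sub_eq_neg_add, Real.rpow_add hr, Real.rpow_one]
        rw [this]
        nlinarith [mul_le_mul_of_nonneg_right h2 hr.le]

/-! ### Counting reduced pairs -/

lemma eventually_linear_le_pow {r : ℝ} (hr : 1 < r) (C D : ℝ) :
    ∀ᶠ j : ℕ in atTop, C * j + D ≤ r ^ j := by
  have h1 : (fun j : ℕ => C * (j : ℝ)) =o[atTop] fun j : ℕ => r ^ j :=
    (isLittleO_coe_const_pow_of_one_lt (R := ℝ) hr).const_mul_left C
  have h2 : (fun _ : ℕ => D) =o[atTop] fun j : ℕ => r ^ j :=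
    Asymptotics.isLittleO_const_left.2 (Or.inr
      (tendsto_norm_atTop_atTop.comp (tendsto_pow_atTop_atTop_of_one_lt hr)))
  filter_upwards [(h1.add h2).bound (by norm_num : (0 : ℝ) < 1)] with j hj
  rw [one_mul, Real.norm_of_nonneg (r := r ^ j) (by positivity)] at hj
  exact (le_abs_self _).trans hj

/-- The product is smallest for `S = {2, …, n + 1}`, in which case it telescopes. -/
lemma inv_card_add_one_le_prod (S : Finset ℕ) (hS : ∀ p ∈ S, 2 ≤ p) :
    ((S.card : ℝ) + 1)⁻¹ ≤ ∏ p ∈ S, (1 - (p : ℝ)⁻¹) := by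
  induction S using Finset.induction_on_max with
  | empty => simp
  | insert a s ha ih =>
    have hnot : a ∉ s := fun h => (ha a h).false
    have ih := ih fun p hp => hS p (Finset.mem_insert_of_mem hp)
    rw [Finset.prod_insert hnot, Finset.card_insert_of_notMem hnot]
    have hcard : s.card + 2 ≤ a := by
      have hsub : s ⊆ Finset.Ico 2 a := fun p hp =>
        Finset.mem_Ico.2 ⟨hS p (Finset.mem_insert_of_mem hp), ha p hp⟩
      have := Finset.card_le_card hsub
      rw [Nat.card_Ico] at this
      have := hS a (Finset.mem_insert_self a s)
      omega
    have hcard' : (s.card : ℝ) + 2 ≤ a := by exact_mod_cast hcard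
    have h1 : (a : ℝ)⁻¹ ≤ ((s.card : ℝ) + 2)⁻¹ := inv_anti₀ (by positivity) hcard'
    have h2 : (((s.card + 1 : ℕ) : ℝ) + 1)⁻¹ =
        (1 - ((s.card : ℝ) + 2)⁻¹) * ((s.card : ℝ) + 1)⁻¹ := by
      push_cast
      field_simp
      ring
    rw [h2]
    exact mul_le_mul (by linarith) ih (by positivity) (by
      have : ((s.card : ℝ) + 2)⁻¹ ≤ 1 := inv_le_one_of_one_le₀ (by linarith)
      linarith)

lemma le_mul_totient {q j : ℕ} (hq : q ≠ 0) (hqj : q < 3 ^ (j + 1)) :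
    q ≤ (2 * j + 3) * q.totient := by
  have hcard : q.primeFactors.card ≤ 2 * j + 2 := by
    have h1 : 2 ^ q.primeFactors.card ≤ ∏ p ∈ q.primeFactors, p :=
      Finset.pow_card_le_prod _ _ _ fun p hp => (Nat.prime_of_mem_primeFactors hp).two_le
    have h2 := Nat.le_of_dvd (Nat.pos_of_ne_zero hq) (Nat.prod_primeFactors_dvd q)
    have h3 : (3 : ℕ) ^ (j + 1) ≤ 2 ^ (2 * (j + 1)) := by
      rw [pow_mul]
      exact Nat.pow_le_pow_left (by norm_num) _
    have := (Nat.pow_lt_pow_iff_right (by norm_num : 1 < 2)).1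
      ((h1.trans h2).trans_lt (hqj.trans_le h3))
    omega
  have hprod := inv_card_add_one_le_prod q.primeFactors
    fun p hp => (Nat.prime_of_mem_primeFactors hp).two_le
  have htot : (q.totient : ℝ) = q * ∏ p ∈ q.primeFactors, (1 - (p : ℝ)⁻¹) := by
    have := congrArg (Rat.cast (K := ℝ)) (Nat.totient_eq_mul_prod_factors q)
    push_cast at this
    exact this
  have hcard' : (q.primeFactors.card : ℝ) + 1 ≤ 2 * j + 3 := by
    have : ((q.primeFactors.card : ℕ) : ℝ) ≤ ((2 * j + 2 : ℕ) : ℝ) := by exact_mod_cast hcard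
    push_cast at this
    linarith
  have h4 : ((2 * j + 3 : ℝ))⁻¹ ≤ ∏ p ∈ q.primeFactors, (1 - (p : ℝ)⁻¹) :=
    (inv_anti₀ (by positivity) hcard').trans hprod
  have h5 : (q : ℝ) ≤ (2 * j + 3) * q.totient := by
    rw [htot]
    calc (q : ℝ) = (2 * j + 3) * (q * (2 * j + 3 : ℝ)⁻¹) := by field_simp
      _ ≤ _ := by gcongr
  exact_mod_cast h5

instance : Countable ReducedPair := inferInstanceAs (Countable {_x : ℕ × ℕ // _})

lemma ReducedPair.den_pos (x : ReducedPair) : 0 < x.den := x.2.1.pos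

lemma finite_block (j : ℕ) : (block j).Finite := by
  refine Set.Finite.of_finite_image (f := Subtype.val) ?_ Subtype.val_injective.injOn
  refine ((finite_Iio (3 ^ (j + 1))).prod (finite_Iio (3 ^ (j + 1)))).subset ?_
  rintro _ ⟨x, hx, rfl⟩
  exact ⟨x.2.1.trans hx.2, hx.2⟩

lemma nine_pow_le_ncard_block (j : ℕ) : 2 * 9 ^ j ≤ (2 * j + 3) * (block j).ncard := by
  classical
  set T : Finset (Σ _ : ℕ, ℕ) :=
    (Finset.Ico (3 ^ j) (3 ^ (j + 1))).sigma fun q => {p ∈ Finset.range q | q.Coprime p} with hT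
  have hTcard : T.card = ∑ q ∈ Finset.Ico (3 ^ j) (3 ^ (j + 1)), q.totient := by
    rw [hT, Finset.card_sigma]
    rfl
  have hle : T.card ≤ (block j).ncard := by
    rw [← Set.ncard_coe_finset]
    refine (Set.ncard_le_ncard ?_ ((finite_block j).image fun x => ⟨x.den, x.1.1⟩)).trans
      (Set.ncard_image_le (finite_block j))
    rintro ⟨q, p⟩ hs
    simp only [hT, Finset.mem_coe, Finset.mem_sigma, Finset.mem_Ico, Finset.mem_filter,
      Finset.mem_range] at hs
    exact ⟨⟨(p, q), hs.2.1, hs.2.2.symm⟩, hs.1, rfl⟩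
  calc 2 * 9 ^ j = ∑ q ∈ Finset.Ico (3 ^ j) (3 ^ (j + 1)), 3 ^ j := by
        rw [Finset.sum_const, Nat.card_Ico, smul_eq_mul, pow_succ, ← Nat.mul_sub_one,
          show 9 = 3 * 3 by norm_num, mul_pow]
        ring
    _ ≤ ∑ q ∈ Finset.Ico (3 ^ j) (3 ^ (j + 1)), (2 * j + 3) * q.totient := by
        refine Finset.sum_le_sum fun q hq => ?_
        have hq := Finset.mem_Ico.1 hq
        exact hq.1.trans (le_mul_totient ((pow_pos (by norm_num) j).trans_le hq.1).ne' hq.2)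
    _ = (2 * j + 3) * T.card := by rw [hTcard, Finset.mul_sum]
    _ ≤ _ := Nat.mul_le_mul_left _ hle

lemma coe_mul_log_three (b : ℝ) (j : ℕ) :
    (b : EReal) * (((j : ℝ) * Real.log 3 : ℝ) : EReal) =
      ENNReal.log (ENNReal.ofReal (3 ^ (b * j))) := by
  rw [ENNReal.log_ofReal_of_pos (by positivity), Real.log_rpow (by norm_num), ← EReal.coe_mul,
    mul_assoc]

lemma eventually_ncard_le {S : Set ReducedPair} {b : ℝ} (h : density S < b) :
    ∀ᶠ j : ℕ in atTop, ((S ∩ block j).ncard : ℝ) ≤ 3 ^ (b * j) := by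
  filter_upwards [eventually_lt_of_limsup_lt h, eventually_gt_atTop 0] with j hj hj0
  have hpos : (0 : EReal) < (((j : ℝ) * Real.log 3 : ℝ) : EReal) :=
    EReal.coe_pos.2 (mul_pos (by exact_mod_cast hj0) (Real.log_pos (by norm_num)))
  rw [EReal.div_lt_iff hpos (EReal.coe_ne_top _), coe_mul_log_three, ENNReal.log_lt_log_iff,
    ← ENNReal.ofReal_natCast] at hj
  exact (ENNReal.ofReal_le_ofReal_iff (by positivity)).1 hj.le

lemma frequently_le_ncard {S : Set ReducedPair} {b : ℝ} (h : b < density S) :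
    ∃ᶠ j : ℕ in atTop, (3 : ℝ) ^ (b * j) ≤ (S ∩ block j).ncard := by
  refine ((frequently_lt_of_lt_limsup (by isBoundedDefault) h).and_eventually
    (eventually_gt_atTop 0)).mono ?_
  rintro j ⟨hj, hj0⟩
  have hpos : (0 : EReal) < (((j : ℝ) * Real.log 3 : ℝ) : EReal) :=
    EReal.coe_pos.2 (mul_pos (by exact_mod_cast hj0) (Real.log_pos (by norm_num)))
  rw [EReal.lt_div_iff hpos (EReal.coe_ne_top _), coe_mul_log_three, ENNReal.log_lt_log_iff,
    ← ENNReal.ofReal_natCast] at hj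
  exact (ENNReal.ofReal_le_ofReal_iff (by positivity)).1 hj.le

/-- Almost all pairs of a large block lie outside of `PK`, because `κ < 1 < 2`. -/
lemma eventually_le_ncard_sdiff {PK : Set ReducedPair} (hPK : density PK = (kappa : EReal))
    {b : ℝ} (hb : b < 2) :
    ∀ᶠ j : ℕ in atTop, (3 : ℝ) ^ (b * j) ≤ (PKᶜ ∩ block j).ncard := by
  -- it suffices to treat an exponent `c ∈ [1, 2)`, so that `3 ^ j ≤ 3 ^ (c * j)`
  set c := max b 1 with hc
  have hc2 : 0 < 2 - c := by
    have := max_lt hb (by norm_num : (1 : ℝ) < 2)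
    linarith
  have h1 : density PK < ((1 : ℝ) : EReal) := by
    rw [hPK]
    exact EReal.coe_lt_coe_iff.2 kappa_lt_one
  have hr : (1 : ℝ) < 3 ^ (2 - c) := Real.one_lt_rpow (by norm_num) hc2
  filter_upwards [eventually_ncard_le h1, eventually_linear_le_pow hr 2 3] with j hj1 hj2
  have hsplit : (block j).ncard ≤ (PK ∩ block j).ncard + (PKᶜ ∩ block j).ncard := by
    refine le_trans (Set.ncard_le_ncard ?_ (((finite_block j).inter_of_right _).union
      ((finite_block j).inter_of_right _))) (Set.ncard_union_le _ _)
    rw [← union_inter_distrib_right, union_compl_self, univ_inter]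
  have hsplit' : ((block j).ncard : ℝ) ≤ (PK ∩ block j).ncard + (PKᶜ ∩ block j).ncard := by
    exact_mod_cast hsplit
  have hblock : (2 : ℝ) * 9 ^ j ≤ (2 * j + 3) * (block j).ncard := by
    exact_mod_cast nine_pow_le_ncard_block j
  have h9 : (9 : ℝ) ^ j = (3 ^ (2 - c)) ^ j * 3 ^ (c * j) := by
    rw [← Real.rpow_natCast (3 ^ (2 - c)), ← Real.rpow_mul (by norm_num),
      ← Real.rpow_add (by norm_num), ← Real.rpow_natCast 9, show (9 : ℝ) = 3 ^ (2 : ℝ) by norm_num,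
      ← Real.rpow_mul (by norm_num)]
    congr 1
    ring
  have h5 : 2 * (3 : ℝ) ^ (c * j) ≤ (block j).ncard := by
    rw [h9] at hblock
    have hp : (0 : ℝ) < 2 * j + 3 := by positivity
    have : (2 * j + 3) * (3 : ℝ) ^ (c * j) ≤ (3 ^ (2 - c)) ^ j * 3 ^ (c * j) := by gcongr
    nlinarith
  have h6 : (3 : ℝ) ^ (1 * (j : ℝ)) ≤ 3 ^ (c * j) :=
    Real.rpow_le_rpow_of_exponent_le (by norm_num)
      (mul_le_mul_of_nonneg_right (le_max_right _ _) (by positivity))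
  have h7 : (3 : ℝ) ^ (b * j) ≤ 3 ^ (c * j) :=
    Real.rpow_le_rpow_of_exponent_le (by norm_num)
      (mul_le_mul_of_nonneg_right (le_max_left _ _) (by positivity))
  linarith

/-! ### Random points in every cylinder -/

/-- Every hull of level `(n, m)` contains one of the points `y x` with `x ∈ S`: each basic
interval of level `n` of the Cantor set contains a basic interval of level `m` that contains one
of these points. -/
def Hits (y : ReducedPair → UnitAddCircle) (S : Set ReducedPair) (n m : ℕ) : Prop :=
  ∀ b : ℕ → Bool, ∃ x ∈ S, y x ∈ hull b n m

lemma two_pow_eq_three_rpow (n : ℕ) : (2 : ℝ) ^ n = 3 ^ (kappa * n) := by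
  rw [Real.rpow_mul (by norm_num), three_rpow_kappa, Real.rpow_natCast]

lemma ofReal_div_le_of_le_two_pow_mul {c : ℝ} {n : ℕ} {z : ℝ≥0∞}
    (h : ENNReal.ofReal c ≤ 2 ^ n * z) : ENNReal.ofReal (c / 2 ^ n) ≤ z := by
  rw [ENNReal.ofReal_div_of_pos (by positivity), ENNReal.ofReal_pow (by norm_num)]
  refine ENNReal.div_le_of_le_mul' ?_
  simpa using h

section Probability

variable {Ω : Type*} [MeasurableSpace Ω] {P : Measure Ω} {PK : Set ReducedPair}
  {Y : ReducedPair → Ω → UnitAddCircle}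

lemma le_measure_hull_of_notMem (hY : IsRandomModel P PK Y) {x : ReducedPair} (hx : x ∉ PK)
    {θ : ℝ} {n m : ℕ} (hnm : n ≤ m) (hn : n ≤ θ * m) (c : ℕ → Bool) :
    ENNReal.ofReal (3 ^ (-((kappa * θ + (1 - kappa)) * m))) ≤ P (Y x ⁻¹' hull c n m) := by
  rw [← Measure.map_apply (hY.measurable x) (measurableSet_hull c n m), hY.law_circle x hx]
  refine le_trans (ENNReal.ofReal_le_ofReal ?_)
    (ofReal_div_le_of_le_two_pow_mul (volume_hull_ge c hnm))
  rw [div_pow, two_pow_eq_three_rpow, two_pow_eq_three_rpow, ← Real.rpow_natCast 3,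
    ← Real.rpow_sub (by norm_num), ← Real.rpow_sub (by norm_num)]
  refine Real.rpow_le_rpow_of_exponent_le (by norm_num) ?_
  nlinarith [mul_le_mul_of_nonneg_left hn kappa_pos.le]

variable [IsProbabilityMeasure P]

lemma measure_forall_notMem_le (hY : IsRandomModel P PK Y) {S : Set ReducedPair} (hS : S.Finite)
    {U : Set UnitAddCircle} (hU : MeasurableSet U) {p : ℝ}
    (hp : ∀ x ∈ S, ENNReal.ofReal p ≤ P (Y x ⁻¹' U)) :
    P {ω | ∀ x ∈ S, Y x ω ∉ U} ≤ ENNReal.ofReal (Real.exp (-(p * S.ncard))) := by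
  lift S to Finset ReducedPair using hS
  have hset : {ω | ∀ x ∈ (S : Set ReducedPair), Y x ω ∉ U} = ⋂ x ∈ S, Y x ⁻¹' Uᶜ := by
    ext ω
    simp
  rw [hset, hY.indep.measure_inter_preimage_eq_mul S (sets := fun _ => Uᶜ) fun _ _ => hU.compl,
    Set.ncard_coe_finset]
  calc ∏ x ∈ S, P (Y x ⁻¹' Uᶜ) ≤ ∏ _x ∈ S, ENNReal.ofReal (Real.exp (-p)) := by
        refine Finset.prod_le_prod' fun x hx => ?_
        rw [preimage_compl, prob_compl_eq_one_sub (hY.measurable x hU)]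
        refine (tsub_le_tsub_left (hp x hx) 1).trans ?_
        rcases le_or_gt p 0 with h | h
        · rw [ENNReal.ofReal_of_nonpos h, tsub_zero, ENNReal.one_le_ofReal]
          exact Real.one_le_exp (by linarith)
        · rw [← ENNReal.ofReal_one, ← ENNReal.ofReal_sub _ h.le]
          refine ENNReal.ofReal_le_ofReal ?_
          linarith [Real.add_one_le_exp (-p)]
    _ = _ := by
        rw [Finset.prod_const, ← ENNReal.ofReal_pow (Real.exp_pos _).le, ← Real.exp_nat_mul]
        congr 2
        ring

lemma measure_not_hits_le (hY : IsRandomModel P PK Y) {S : Set ReducedPair} (hS : S.Finite)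
    {n m : ℕ} {p : ℝ} (hp : ∀ x ∈ S, ∀ b, ENNReal.ofReal p ≤ P (Y x ⁻¹' hull b n m)) :
    P {ω | ¬ Hits (fun x => Y x ω) S n m} ≤
      ENNReal.ofReal (2 ^ n * Real.exp (-(p * S.ncard))) := by
  have hsub : {ω | ¬ Hits (fun x => Y x ω) S n m} ⊆
      ⋃ w : Fin n → Bool, {ω | ∀ x ∈ S, Y x ω ∉ hull (pad w) n m} := by
    intro ω hω
    simp only [Hits, mem_ofPred_eq, not_forall, not_exists, not_and] at hω
    obtain ⟨b, hb⟩ := hω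
    refine mem_iUnion.2 ⟨fun i => b i, fun x hx => ?_⟩
    rw [hull, agree_eq_of_mem (pad_restrict_mem_agree b n)]
    exact hb x hx
  calc _ ≤ ∑' w : Fin n → Bool, P {ω | ∀ x ∈ S, Y x ω ∉ hull (pad w) n m} :=
        (measure_mono hsub).trans (measure_iUnion_le _)
    _ ≤ ∑' _w : Fin n → Bool, ENNReal.ofReal (Real.exp (-(p * S.ncard))) :=
        ENNReal.tsum_le_tsum fun w => measure_forall_notMem_le hY hS (measurableSet_hull _ n m)
          fun x hx => hp x hx _
    _ = _ := by
        rw [tsum_fintype, ENNReal.ofReal_mul (p := 2 ^ n) (by positivity),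
          ENNReal.ofReal_pow (by norm_num)]
        simp

/-- If the points of `T j` are so numerous that the expected number of them in a hull grows
exponentially along the `j` with `J j`, then almost surely they hit all hulls for all large such
`j`: the failure probabilities decay doubly exponentially, while the number of hulls grows only
exponentially. -/
lemma ae_eventually_hits (hY : IsRandomModel P PK Y) {a b μ : ℝ} (ha : 0 ≤ a) (hμ : 0 < μ)
    (hab : a * μ < b) {T : ℕ → Set ReducedPair} (hT : ∀ j, (T j).Finite) {J : ℕ → Prop}
    {n : ℕ → ℕ} (hn : ∀ j, n j ≤ ⌈μ * (j + 1)⌉₊)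
    (hcard : ∀ᶠ j in atTop, J j → (3 : ℝ) ^ (b * j) ≤ (T j).ncard)
    (hp : ∀ j, ∀ x ∈ T j, ∀ c, ENNReal.ofReal (3 ^ (-(a * ⌈μ * (j + 1)⌉₊))) ≤
      P (Y x ⁻¹' hull c (n j) ⌈μ * (j + 1)⌉₊)) :
    ∀ᵐ ω ∂P, ∀ᶠ j in atTop, J j → Hits (fun x => Y x ω) (T j) (n j) ⌈μ * (j + 1)⌉₊ := by
  set m : ℕ → ℕ := fun j => ⌈μ * (j + 1)⌉₊ with hm
  have hmle : ∀ j : ℕ, (m j : ℝ) ≤ μ * j + (μ + 1) := fun j => by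
    have := (Nat.ceil_lt_add_one (show 0 ≤ μ * ((j : ℝ) + 1) by positivity)).le
    simp only [hm]
    linarith
  have hr : (1 : ℝ) < 3 ^ (b - a * μ) := Real.one_lt_rpow (by norm_num) (by linarith)
  set c : ℝ := 3 ^ (-(a * (μ + 1))) with hc
  have hc0 : 0 < c := by positivity
  -- the exponential growth of the expectation
  have hexp : ∀ j : ℕ, c * (3 ^ (b - a * μ)) ^ j ≤ 3 ^ (-(a * m j)) * 3 ^ (b * j) := fun j => by
    rw [hc, ← Real.rpow_natCast, ← Real.rpow_mul (by norm_num), ← Real.rpow_add (by norm_num),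
      ← Real.rpow_add (by norm_num)]
    refine Real.rpow_le_rpow_of_exponent_le (by norm_num) ?_
    have := mul_le_mul_of_nonneg_left (hmle j) ha
    nlinarith
  have hbound : ∀ᶠ j : ℕ in atTop,
      P {ω | J j ∧ ¬ Hits (fun x => Y x ω) (T j) (n j) (m j)} ≤
        ENNReal.ofReal (Real.exp (-j)) := by
    filter_upwards [hcard,
      eventually_linear_le_pow hr (c⁻¹ * (μ + 1)) (c⁻¹ * (μ + 1))] with j hj hlin
    by_cases hJ : J j
    · simp only [hJ, true_and]
      refine (measure_not_hits_le hY (hT j) (hp j)).trans (ENNReal.ofReal_le_ofReal ?_)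
      have h2 : (2 : ℝ) ^ n j ≤ Real.exp (m j) := by
        rw [← Real.exp_one_pow]
        calc (2 : ℝ) ^ n j ≤ 2 ^ m j := pow_le_pow_right₀ (by norm_num) (hn j)
          _ ≤ _ := by
            gcongr
            linarith [Real.add_one_le_exp (1 : ℝ)]
      calc _ ≤ Real.exp (m j) * Real.exp (-(3 ^ (-(a * m j)) * (T j).ncard)) := by gcongr
        _ = Real.exp (m j - 3 ^ (-(a * m j)) * (T j).ncard) := by
          rw [← Real.exp_add, sub_eq_add_neg]
        _ ≤ Real.exp (-j) := by
          refine Real.exp_le_exp.2 ?_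
          have h3 : c * (c⁻¹ * (μ + 1) * j + c⁻¹ * (μ + 1)) ≤ c * (3 ^ (b - a * μ)) ^ j := by
            gcongr
          have h4 : c * (c⁻¹ * (μ + 1) * j + c⁻¹ * (μ + 1)) = (μ + 1) * j + (μ + 1) := by
            field_simp
          have h5 : (3 : ℝ) ^ (-(a * m j)) * 3 ^ (b * j) ≤ 3 ^ (-(a * m j)) * (T j).ncard := by
            gcongr
            exact hj hJ
          linarith [hexp j, hmle j]
    · simp [hJ]
  obtain ⟨N, hN⟩ := eventually_atTop.1 hbound
  have hsum : ∑' j : ℕ, P {ω | J (j + N) ∧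
      ¬ Hits (fun x => Y x ω) (T (j + N)) (n (j + N)) (m (j + N))} ≠ ∞ := by
    refine ne_top_of_le_ne_top (Real.summable_exp_neg_nat.tsum_ofReal_ne_top)
      (ENNReal.tsum_le_tsum fun j => (hN (j + N) (by omega)).trans ?_)
    refine ENNReal.ofReal_le_ofReal (Real.exp_le_exp.2 ?_)
    push_cast
    linarith [(Nat.cast_nonneg N : (0 : ℝ) ≤ N)]
  filter_upwards [ae_eventually_notMem hsum] with ω hω
  obtain ⟨M, hM⟩ := eventually_atTop.1 hω
  refine eventually_atTop.2 ⟨M + N, fun j hj hJ => ?_⟩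
  have := hM (j - N) (by omega)
  rw [Nat.sub_add_cancel (by omega)] at this
  by_contra hcon
  exact this ⟨hJ, hcon⟩

lemma le_measure_hull_of_mem (hY : IsRandomModel P PK Y) {x : ReducedPair} (hx : x ∈ PK)
    {θ : ℝ} {n m : ℕ} (hn : n ≤ θ * m) (c : ℕ → Bool) :
    ENNReal.ofReal (3 ^ (-(kappa * θ * m))) ≤ P (Y x ⁻¹' hull c n m) := by
  have hK : MeasurableSet cantorCircle := isCompact_cantorCircle.measurableSet
  -- the law is a probability measure, so that the total mass of the Cantor set cancels
  have hone : (μH[kappa] cantorCircle)⁻¹ * μH[kappa] cantorCircle = 1 := by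
    have := (Measure.isProbabilityMeasure_map (μ := P) (hY.measurable x).aemeasurable).measure_univ
    rw [hY.law_cantor x hx] at this
    simpa using this
  rw [← Measure.map_apply (hY.measurable x) (measurableSet_hull c n m), hY.law_cantor x hx,
    Measure.smul_apply, Measure.restrict_apply (measurableSet_hull c n m), smul_eq_mul]
  have hle : ENNReal.ofReal 1 ≤
      2 ^ n * ((μH[kappa] cantorCircle)⁻¹ * μH[kappa] (hull c n m ∩ cantorCircle)) := by
    rw [ENNReal.ofReal_one, ← hone, mul_left_comm]
    refine mul_le_mul_right ((hausdorffMeasure_cylinder_ge c n).trans ?_) _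
    exact mul_le_mul_right (measure_mono
      (subset_inter (cylinder_subset_hull c n m) (cylinder_subset_cantorCircle c n))) _
  refine le_trans (ENNReal.ofReal_le_ofReal ?_) (ofReal_div_le_of_le_two_pow_mul hle)
  rw [one_div, two_pow_eq_three_rpow, ← Real.rpow_neg (by norm_num)]
  refine Real.rpow_le_rpow_of_exponent_le (by norm_num) ?_
  nlinarith [mul_le_mul_of_nonneg_left hn kappa_pos.le]

/-- The points outside of `PK`. The bound on `θ` says that the expected number of such points of
the `j`-th block in a hull of level `(θ m, m)`, `m ≈ μ j`, grows exponentially. -/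
lemma ae_eventually_hits_sdiff (hPK : density PK = (kappa : EReal)) (hY : IsRandomModel P PK Y)
    {θ μ : ℝ} (hθ0 : 0 ≤ θ) (hθ1 : θ ≤ 1) (hμ : 0 < μ)
    (hθ : (kappa * θ + (1 - kappa)) * μ < 2) :
    ∀ᵐ ω ∂P, ∀ᶠ j : ℕ in atTop,
      Hits (fun x => Y x ω) (block j) ⌊θ * ⌈μ * (j + 1)⌉₊⌋₊ ⌈μ * (j + 1)⌉₊ := by
  obtain ⟨b, hb1, hb2⟩ := exists_between hθ
  have hle : ∀ m : ℕ, (⌊θ * m⌋₊ : ℝ) ≤ θ * m := fun m => Nat.floor_le (by positivity)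
  have hnm : ∀ m : ℕ, ⌊θ * m⌋₊ ≤ m := fun m => by
    exact_mod_cast (hle m).trans (mul_le_of_le_one_left (Nat.cast_nonneg m) hθ1)
  have h := ae_eventually_hits hY (a := kappa * θ + (1 - kappa)) (b := b) (μ := μ)
    (T := fun j => PKᶜ ∩ block j) (J := fun _ => True) (n := fun j => ⌊θ * ⌈μ * (j + 1)⌉₊⌋₊)
    (by nlinarith [mul_nonneg kappa_pos.le hθ0, kappa_lt_one]) hμ hb1
    (fun j => (finite_block j).inter_of_right _) (fun j => hnm _)
    ((eventually_le_ncard_sdiff hPK hb2).mono fun j hj _ => hj)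
    (fun j x hx c => le_measure_hull_of_notMem hY hx.1 (hnm _) (hle _) c)
  filter_upwards [h] with ω hω
  filter_upwards [hω] with j hj c
  obtain ⟨x, hx, hxc⟩ := hj trivial c
  exact ⟨x, hx.2, hxc⟩

/-- The points in `PK`, of which there are enough for infinitely many `j` only. -/
lemma ae_frequently_hits (hPK : density PK = (kappa : EReal)) (hY : IsRandomModel P PK Y)
    {θ μ : ℝ} (hθ0 : 0 ≤ θ) (hθ1 : θ ≤ 1) (hμ : 0 < μ) (hθ : θ * μ < 1) :
    ∀ᵐ ω ∂P, ∃ᶠ j : ℕ in atTop,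
      Hits (fun x => Y x ω) (block j) ⌊θ * ⌈μ * (j + 1)⌉₊⌋₊ ⌈μ * (j + 1)⌉₊ := by
  have hθ' : kappa * θ * μ < kappa := by nlinarith [kappa_pos]
  obtain ⟨b, hb1, hb2⟩ := exists_between hθ'
  have hle : ∀ m : ℕ, (⌊θ * m⌋₊ : ℝ) ≤ θ * m := fun m => Nat.floor_le (by positivity)
  have hnm : ∀ m : ℕ, ⌊θ * m⌋₊ ≤ m := fun m => by
    exact_mod_cast (hle m).trans (mul_le_of_le_one_left (Nat.cast_nonneg m) hθ1)
  have h := ae_eventually_hits hY (a := kappa * θ) (b := b) (μ := μ)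
    (T := fun j => PK ∩ block j) (J := fun j => (3 : ℝ) ^ (b * j) ≤ (PK ∩ block j).ncard)
    (n := fun j => ⌊θ * ⌈μ * (j + 1)⌉₊⌋₊) (mul_nonneg kappa_pos.le hθ0) hμ hb1
    (fun j => (finite_block j).inter_of_right _) (fun j => hnm _)
    (Eventually.of_forall fun j hj => hj)
    (fun j x hx c => le_measure_hull_of_mem hY hx.1 (hle _) c)
  have hfreq := frequently_le_ncard (S := PK) (b := b)
    (by rw [hPK]; exact EReal.coe_lt_coe_iff.2 hb2)
  filter_upwards [h] with ω hω
  refine (hfreq.and_eventually hω).mono fun j hj c => ?_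
  obtain ⟨x, hx, hxc⟩ := hj.2 hj.1 c
  exact ⟨x, hx.2, hxc⟩

end Probability

/-! ### The lower bound for the dimension -/

/-- If the points `g s` determine the numbers `h s` in a Hölder continuous way, and these fill the
unit interval, then the points form a set whose dimension is at least the Hölder exponent. -/
lemma le_dimH_range_of_holder {σ X : Type*} [MetricSpace X] {g : σ → X} {h : σ → ℝ} {C r : ℝ≥0}
    (hr : 0 < r) (hgh : ∀ s t, |h s - h t| ≤ C * dist (g s) (g t) ^ (r : ℝ))
    (hh : Icc 0 1 ⊆ range h) : (r : ℝ≥0∞) ≤ dimH (range g) := by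
  classical
  set f : X → ℝ := fun x => if hx : ∃ s, g s = x then h hx.choose else 0 with hf
  have hfg : ∀ s, f (g s) = h s := by
    intro s
    have hx : ∃ t, g t = g s := ⟨s, rfl⟩
    have h1 := hgh hx.choose s
    rw [hx.choose_spec, dist_self, Real.zero_rpow (by exact_mod_cast hr.ne'), mul_zero] at h1
    simp only [hf, dif_pos hx]
    exact sub_eq_zero.1 (abs_nonpos_iff.1 h1)
  have hhold : HolderOnWith C r f (range g) := by
    rintro _ ⟨s, rfl⟩ _ ⟨t, rfl⟩
    rw [hfg, hfg, edist_dist, edist_dist, ENNReal.ofReal_rpow_of_nonneg dist_nonneg r.coe_nonneg,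
      ← ENNReal.ofReal_coe_nnreal, ← ENNReal.ofReal_mul C.coe_nonneg]
    exact ENNReal.ofReal_le_ofReal (hgh s t)
  have himage : f '' range g = range h := by
    rw [← range_comp]
    exact congrArg range (funext hfg)
  have h1 : (1 : ℝ≥0∞) ≤ dimH (range h) := by
    have : dimH (Icc (0 : ℝ) 1) = 1 := by
      rw [Real.dimH_of_nonempty_interior (by simp)]
      simp
    exact this ▸ dimH_mono hh
  have h2 := h1.trans (himage ▸ hhold.dimH_image_le hr)
  have h3 := (ENNReal.le_div_iff_mul_le (Or.inl (by exact_mod_cast hr.ne'))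
    (Or.inl ENNReal.coe_ne_top)).1 h2
  rwa [one_mul] at h3

lemma le_abs_codePoint_sub {v w : ℕ → Bool} {p : ℕ} (hvw : v ∈ agree w p) (hp : v p ≠ w p) :
    ((3 : ℝ) ^ (p + 1))⁻¹ ≤ |codePoint v - codePoint w| := by
  wlog h : v p = true generalizing v w
  · rw [abs_sub_comm]
    refine this (fun i hi => (hvw i hi).symm) hp.symm ?_
    cases hv : v p <;> cases hw : w p <;> simp_all
  have hw : w p = false := by
    cases hw : w p <;> simp_all
  have h1 := (codePoint_mem_Icc v (p + 1)).1
  have h2 := (codePoint_mem_Icc w (p + 1)).2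
  have h3 : leftEnd v (p + 1) = leftEnd w (p + 1) + 2 * ((3 : ℝ) ^ (p + 1))⁻¹ := by
    have := leftEnd_congr hvw
    rw [leftEnd, leftEnd] at this
    rw [leftEnd, leftEnd, Finset.sum_range_succ, Finset.sum_range_succ, this]
    simp [Real.ofDigitsTerm, ternary, h, hw]
  refine le_trans ?_ (le_abs_self _)
  linarith

lemma codePoint_le_third {v : ℕ → Bool} (hv : v 0 = false) : codePoint v ∈ Icc (0 : ℝ) (1 / 3) := by
  have h := codePoint_mem_Icc v 1
  have h1 : leftEnd v 1 = 0 := by simp [leftEnd, Real.ofDigitsTerm, ternary, hv]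
  rw [h1] at h
  constructor
  · exact h.1
  · have := h.2
    norm_num at this ⊢
    exact this

/-- Sequences that start with `0` code points in an arc shorter than a half circle, on which the
quotient map is an isometry. -/
lemma dist_codePoint {v w : ℕ → Bool} (hv : v 0 = false) (hw : w 0 = false) :
    dist (codePoint v : UnitAddCircle) (codePoint w : UnitAddCircle) =
      |codePoint v - codePoint w| := by
  have h1 := codePoint_le_third hv
  have h2 := codePoint_le_third hw
  rw [dist_eq_norm, ← AddCircle.coe_sub, AddCircle.norm_coe_eq_abs_iff _ one_ne_zero]
  rw [abs_one, abs_le]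
  constructor <;> linarith [h1.1, h1.2, h2.1, h2.2]

lemma count_eq_add_sub {p : ℕ → Prop} [DecidablePred p] {a l : ℕ} (hal : a ≤ l)
    (h : ∀ i, a ≤ i → i < l → p i) : Nat.count p l = Nat.count p a + (l - a) := by
  obtain ⟨c, rfl⟩ := Nat.exists_eq_add_of_le hal
  rw [Nat.count_add, Nat.add_sub_cancel_left]
  congr 1
  exact Nat.count_iff_forall.2 fun i hi => h _ (by omega) (by omega)

/-- The construction of points of the limsup set: the digits in the windows `[n k, m k)` are
prescribed by the maps `e k` (in terms of the digits in front of the window), all other digits are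
copied from `u`. This is the sequence after the first `k` windows have been treated. -/
def windowSeq (m : ℕ → ℕ) (e : ℕ → (ℕ → Bool) → ℕ → Bool) (u : ℕ → Bool) : ℕ → ℕ → Bool
  | 0 => u
  | k + 1 => fun i => if i < m k then e k (windowSeq m e u k) i else u i

/-- The limit of `windowSeq`: the digit at position `i` is not changed after step `i + 1`. -/
def windowLimit (m : ℕ → ℕ) (e : ℕ → (ℕ → Bool) → ℕ → Bool) (u : ℕ → Bool) : ℕ → Bool :=
  fun i => windowSeq m e u (i + 1) i

section Windows

variable {n m : ℕ → ℕ} {e : ℕ → (ℕ → Bool) → ℕ → Bool}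

lemma windowSeq_succ (u : ℕ → Bool) (k i : ℕ) :
    windowSeq m e u (k + 1) i = if i < m k then e k (windowSeq m e u k) i else u i := rfl

lemma windowSeq_stable (hnm : ∀ k, n k ≤ m k) (hmn : ∀ k, m k ≤ n (k + 1))
    (he : ∀ k b, e k b ∈ agree b (n k)) (u : ℕ → Bool) {k l i : ℕ} (hkl : k ≤ l) (hi : i < n k) :
    windowSeq m e u l i = windowSeq m e u k i := by
  have hmono : Monotone n := monotone_nat_of_le_succ fun k => (hnm k).trans (hmn k)
  induction l, hkl using Nat.le_induction with
  | base => rfl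
  | succ l hkl ih =>
    have hil : i < n l := hi.trans_le (hmono hkl)
    rw [windowSeq_succ, if_pos (hil.trans_le (hnm l)), he l _ i hil, ih]

lemma windowLimit_eq (hnm : ∀ k, n k ≤ m k) (hmn : ∀ k, m k ≤ n (k + 1)) (hn : ∀ k, k < n k)
    (he : ∀ k b, e k b ∈ agree b (n k)) (u : ℕ → Bool) {k i : ℕ} (hi : i < n k) :
    windowLimit m e u i = windowSeq m e u k i := by
  have hi' : i < n (i + 1) := (Nat.lt_succ_self i).trans (hn (i + 1))
  rw [windowLimit, ← windowSeq_stable hnm hmn he u (le_max_left (i + 1) k) hi',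
    ← windowSeq_stable hnm hmn he u (le_max_right (i + 1) k) hi]

lemma windowLimit_mem_agree (hnm : ∀ k, n k ≤ m k) (hmn : ∀ k, m k ≤ n (k + 1))
    (hn : ∀ k, k < n k) (he : ∀ k b, e k b ∈ agree b (n k)) (u : ℕ → Bool) (k : ℕ) :
    windowLimit m e u ∈ agree (e k (windowSeq m e u k)) (m k) := by
  intro i hi
  rw [windowLimit_eq hnm hmn hn he u (hi.trans_le (hmn k)), windowSeq_succ, if_pos hi]

lemma windowLimit_free (he : ∀ k b, e k b ∈ agree b (n k)) (u : ℕ → Bool) {i : ℕ}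
    (hi : ∀ k, i < m k → i < n k) : windowLimit m e u i = u i := by
  have : ∀ k, windowSeq m e u k i = u i := by
    intro k
    induction k with
    | zero => rfl
    | succ k ih =>
      rw [windowSeq_succ]
      split_ifs with h
      · rw [he k _ i (hi k h), ih]
      · rfl
  exact this _

/-- If each window `[n k, m k)` starts late enough after the end `d k` of the previous one, then
the positions outside of the windows have lower density at least `θ`. The position `0` is not
counted. -/
lemma mul_le_count_free {d : ℕ → ℕ} {θ : ℝ} (hθ0 : 0 ≤ θ) (hθ1 : θ ≤ 1) (hd0 : d 0 = 1)
    (hd : ∀ k, d (k + 1) = m k) (hlt : ∀ k, d k < d (k + 1)) (hnm : ∀ k, n k ≤ m k)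
    (hdn : ∀ k, d k + θ * m k ≤ n k)
    {F : ℕ → Prop} [DecidablePred F] (hF : ∀ i, F i ↔ i ≠ 0 ∧ ∀ k, i < m k → i < n k) (l : ℕ) :
    θ * l ≤ Nat.count F l + 1 := by
  have hdn' : ∀ k, d k ≤ n k := fun k => by
    have : (d k : ℝ) ≤ n k := (le_add_of_nonneg_right (by positivity)).trans (hdn k)
    exact_mod_cast this
  have hdmono : StrictMono d := strictMono_nat_of_lt_succ hlt
  have hfree : ∀ k i, d k ≤ i → i < n k → F i := by
    intro k i h1 h2
    refine (hF i).2 ⟨?_, fun k' hk' => ?_⟩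
    · have := hdmono.monotone (Nat.zero_le k)
      omega
    · rcases lt_trichotomy k' k with h | rfl | h
      · have := hdmono.monotone (Nat.succ_le_of_lt h)
        rw [Nat.succ_eq_add_one, hd] at this
        omega
      · exact h2
      · have := hdmono.monotone (Nat.succ_le_of_lt h)
        rw [Nat.succ_eq_add_one, hd] at this
        have := hdn' k'
        have := hnm k
        omega
  have key : ∀ k l, l ≤ d k → θ * l ≤ Nat.count F l + 1 := by
    intro k
    induction k with
    | zero =>
      intro l hl
      rw [hd0] at hl
      have : (l : ℝ) ≤ 1 := by exact_mod_cast hl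
      have : θ * l ≤ 1 := mul_le_one₀ hθ1 (by positivity) this
      linarith [(Nat.cast_nonneg (Nat.count F l) : (0 : ℝ) ≤ _)]
    | succ k ih =>
      intro l hl
      have hmid : ∀ l, d k ≤ l → l ≤ n k →
          (Nat.count F l : ℝ) = Nat.count F (d k) + (l - d k) := by
        intro l h1 h2
        have := count_eq_add_sub (p := F) h1 fun i hi1 hi2 => hfree k i hi1 (hi2.trans_le h2)
        rw [this, Nat.cast_add, Nat.cast_sub h1]
      rcases le_total l (d k) with h1 | h1
      · exact ih l h1
      rcases le_total l (n k) with h2 | h2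
      · rw [hmid l h1 h2]
        have h3 := ih (d k) le_rfl
        have h4 : (d k : ℝ) ≤ l := by exact_mod_cast h1
        nlinarith
      · have h3 : (Nat.count F (n k) : ℝ) ≤ Nat.count F l := by
          exact_mod_cast Nat.count_monotone F h2
        rw [hmid (n k) (hdn' k) le_rfl] at h3
        have h4 : (l : ℝ) ≤ m k := by
          rw [hd] at hl
          exact_mod_cast hl
        have h5 := mul_le_mul_of_nonneg_left h4 hθ0
        have := hdn k
        linarith [(Nat.cast_nonneg (Nat.count F (d k)) : (0 : ℝ) ≤ _)]
  exact key l l (hdmono.id_le l)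

end Windows

lemma dist_lt_of_mem_arc {y : UnitAddCircle} {μ : ℝ} (hμ : 0 < μ) {j m : ℕ}
    (hjm : μ * (j + 1) ≤ m) {x : ReducedPair} (hx : x ∈ block j) {b : ℕ → Bool} {ξ : UnitAddCircle}
    (hξ : ξ ∈ arc b m) (hy : y ∈ arc b m) : dist ξ y < (x.den : ℝ) ^ (-μ) := by
  refine (dist_le_of_mem_arc hξ hy).trans_lt ?_
  have hq0 : (0 : ℝ) < x.den := Nat.cast_pos.2 x.den_pos
  have hq3 : (x.den : ℝ) < 3 ^ (j + 1) := by exact_mod_cast hx.2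
  rw [Real.rpow_neg hq0.le]
  refine inv_strictAnti₀ (Real.rpow_pos_of_pos hq0 μ) ?_
  calc (x.den : ℝ) ^ μ < (3 ^ (j + 1)) ^ μ := Real.rpow_lt_rpow hq0.le hq3 hμ
    _ = 3 ^ (μ * (j + 1)) := by
      rw [← Real.rpow_natCast, ← Real.rpow_mul (by norm_num), mul_comm]
      push_cast
      rfl
    _ ≤ 3 ^ (m : ℝ) := Real.rpow_le_rpow_of_exponent_le (by norm_num) hjm
    _ = 3 ^ m := Real.rpow_natCast _ _

lemma eq_of_mem_block {x : ReducedPair} {j l : ℕ} (hj : x ∈ block j) (hl : x ∈ block l) :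
    j = l := by
  have h1 := (Nat.pow_lt_pow_iff_right (by norm_num : 1 < 3)).1 (hj.1.trans_lt hl.2)
  have h2 := (Nat.pow_lt_pow_iff_right (by norm_num : 1 < 3)).1 (hl.1.trans_lt hj.2)
  omega

/-- If infinitely many scales hit all hulls, then the points whose codes follow the hits in a
sparse sequence of windows are well approximable. Reading the digits outside of the windows in
base `2` maps these points onto the unit interval, and this map is Hölder continuous because the
free positions have lower density `θ`. -/
theorem le_dimH_approxSet_inter {y : ReducedPair → UnitAddCircle} {μ θ : ℝ} (hμ : 1 ≤ μ)
    (hθ0 : 0 < θ) (hθ1 : θ ≤ 1)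
    (h : ∀ M : ℕ, ∃ j n m : ℕ, M ≤ j ∧ n ≤ m ∧ M + θ * m ≤ n ∧ μ * (j + 1) ≤ m ∧
      Hits y (block j) n m) :
    ENNReal.ofReal (kappa * θ) ≤ dimH (approxSet y μ ∩ cantorCircle) := by
  classical
  choose J N M hJ hNM hsep hMJ hhit using h
  choose x hx hxmem using hhit
  have hex : ∀ k b, ∃ v ∈ agree b (N k), y (x k b) ∈ arc v (M k) := fun k b => by
    simpa [hull] using hxmem k b
  choose e he harc using hex
  -- the scales used: each one starts beyond the end `d k` of the previous one
  set d : ℕ → ℕ := fun k => M^[k] 1 with hd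
  have hd0 : d 0 = 1 := rfl
  have hds : ∀ k, d (k + 1) = M (d k) := fun k => Function.iterate_succ_apply' M k 1
  have hJM : ∀ k, J k < M k := fun k => by
    have h1 : ((J k : ℝ) + 1) ≤ M k := by nlinarith [hMJ k, (Nat.cast_nonneg (J k) : (0 : ℝ) ≤ _)]
    exact_mod_cast h1
  have hlt : ∀ k, d k < d (k + 1) := fun k => by
    rw [hds]
    exact (hJ _).trans_lt (hJM _)
  have hdmono : StrictMono d := strictMono_nat_of_lt_succ hlt
  have hdN : ∀ k, d k ≤ N (d k) := fun k => by
    have h1 : (d k : ℝ) ≤ N (d k) := (le_add_of_nonneg_right (by positivity)).trans (hsep (d k))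
    exact_mod_cast h1
  have hnm : ∀ k, N (d k) ≤ M (d k) := fun k => hNM _
  have hmn : ∀ k, M (d k) ≤ N (d (k + 1)) := fun k => by
    rw [← hds]
    exact hdN (k + 1)
  have hn : ∀ k, k < N (d k) := fun k => by
    have h1 := hdmono.add_le_nat k 0
    rw [hd0, add_zero] at h1
    have h2 := hdN k
    omega
  set F : ℕ → Prop := fun i => i ≠ 0 ∧ ∀ k, i < M (d k) → i < N (d k) with hF
  have hcount : ∀ l : ℕ, θ * l ≤ Nat.count F l + 1 :=
    mul_le_count_free hθ0.le hθ1 hd0 hds hlt hnm (fun k => hsep (d k)) fun _ => Iff.rfl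
  have hFinf : (Set.ofPred F).Infinite := by
    intro hfin
    obtain ⟨l, hl⟩ := exists_nat_gt ((hfin.toFinset.card + 1 : ℝ) / θ)
    rw [div_lt_iff₀ hθ0] at hl
    have h1 := hcount l
    have h2 : Nat.count F l ≤ hfin.toFinset.card := by
      rw [Nat.count_eq_card_filter_range]
      refine Finset.card_le_card fun i hi => ?_
      simpa using (Finset.mem_filter.1 hi).2
    have h3 : (Nat.count F l : ℝ) ≤ hfin.toFinset.card := by exact_mod_cast h2
    linarith
  set u : (ℕ → Fin 2) → ℕ → Bool :=
    fun s i => if i = 0 then false else decide (s (Nat.count F i) = 1) with hu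
  set c : (ℕ → Fin 2) → ℕ → Bool :=
    fun s => windowLimit (fun k => M (d k)) (fun k => e (d k)) (u s) with hc
  have hc0 : ∀ s, c s 0 = false := fun s => by
    have h1 := windowLimit_eq (n := fun k => N (d k)) (m := fun k => M (d k))
      (e := fun k => e (d k)) hnm hmn hn (fun k => he (d k)) (u s)
      (k := 0) (i := 0) (hn 0)
    refine h1.trans ?_
    simp [windowSeq, hu]
  have hcF : ∀ s i, F i → c s i = u s i := fun s i hi =>
    windowLimit_free (n := fun k => N (d k)) (fun k => he (d k)) (u s) hi.2
  have hsubset : range (fun s => (codePoint (c s) : UnitAddCircle)) ⊆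
      approxSet y μ ∩ cantorCircle := by
    rintro _ ⟨s, rfl⟩
    refine ⟨?_, by rw [cantorCircle_eq_range]; exact mem_range_self _⟩
    set b : ℕ → ℕ → Bool :=
      windowSeq (fun k => M (d k)) (fun k => e (d k)) (u s) with hb
    refine Set.infinite_of_injective_forall_mem (f := fun k => x (d k) (b k)) ?_ ?_
    · -- points of different blocks are different
      have hJd : StrictMono fun k => J (d k) := strictMono_nat_of_lt_succ fun k => by
        refine (hJM (d k)).trans_le ?_
        rw [← hds]
        exact hJ _
      intro k l hkl
      have h1 := hx (d k) (b k)
      have h2 := hx (d l) (b l)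
      simp only at hkl
      rw [hkl] at h1
      exact hJd.injective (eq_of_mem_block h1 h2)
    · intro k
      have hagree : c s ∈ agree (e (d k) (b k)) (M (d k)) :=
        windowLimit_mem_agree (n := fun k => N (d k)) hnm hmn hn (fun k => he (d k)) (u s) k
      have h1 : (codePoint (c s) : UnitAddCircle) ∈ arc (e (d k) (b k)) (M (d k)) :=
        arc_congr hagree ▸ codePoint_mem_arc (c s) (M (d k))
      exact dist_lt_of_mem_arc (by linarith) (hMJ (d k)) (hx (d k) (b k)) h1 (harc (d k) (b k))
  refine le_trans ?_ (dimH_mono hsubset)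
  have hκθ : 0 < kappa * θ := mul_pos kappa_pos hθ0
  have hholder : ∀ s t : ℕ → Fin 2, |Real.ofDigits s - Real.ofDigits t| ≤
      ((9 : ℝ≥0) : ℝ) * dist (codePoint (c s) : UnitAddCircle) (codePoint (c t) : UnitAddCircle) ^
        (((kappa * θ).toNNReal : ℝ≥0) : ℝ) := by
    intro s t
    rw [Real.coe_toNNReal _ hκθ.le, dist_codePoint (hc0 s) (hc0 t)]
    by_cases hst : s = t
    · subst hst
      rw [sub_self, abs_zero]
      positivity
    -- `r` is the first index where `s` and `t` differ, which is copied to the position `p`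
    have hne : ∃ r, s r ≠ t r := Function.ne_iff.1 hst
    set r := Nat.find hne with hr
    have hrne : s r ≠ t r := Nat.find_spec hne
    have hreq : ∀ i < r, s i = t i := fun i hi => not_not.1 (Nat.find_min hne hi)
    set p := Nat.nth F r with hp
    have hFp : F p := Nat.nth_mem_of_infinite hFinf r
    have hcp : Nat.count F p = r := Nat.count_nth_of_infinite hFinf r
    have hcne : c s p ≠ c t p := by
      rw [hcF s p hFp, hcF t p hFp]
      simp only [hu, hFp.1, if_false, hcp]
      intro heq
      apply hrne
      rw [decide_eq_decide] at heq
      omega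
    have hne' : ∃ i, c s i ≠ c t i := ⟨p, hcne⟩
    have hfind : Nat.find hne' ≤ p := Nat.find_min' hne' hcne
    have hdist : ((3 : ℝ) ^ (p + 1))⁻¹ ≤ |codePoint (c s) - codePoint (c t)| := by
      refine le_trans ?_ (le_abs_codePoint_sub (p := Nat.find hne')
        (fun i hi => not_not.1 (Nat.find_min hne' hi)) (Nat.find_spec hne'))
      exact inv_anti₀ (by positivity) (pow_le_pow_right₀ (by norm_num) (by omega))
    have hleft := Real.abs_ofDigits_sub_ofDigits_le hreq
    have hcountp := hcount p
    rw [hcp] at hcountp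
    calc |Real.ofDigits s - Real.ofDigits t| ≤ ((2 : ℝ) ^ r)⁻¹ := by exact_mod_cast hleft
      _ = 3 ^ (-(kappa * r)) := by rw [two_pow_eq_three_rpow, Real.rpow_neg (by norm_num)]
      _ ≤ 3 ^ (2 + -((p + 1) * (kappa * θ))) := by
        refine Real.rpow_le_rpow_of_exponent_le (by norm_num) ?_
        have h1 := mul_le_mul_of_nonneg_left hcountp kappa_pos.le
        have h2 := mul_le_mul_of_nonneg_left hθ1 kappa_pos.le
        have h3 := kappa_lt_one
        linarith
      _ = 9 * (((3 : ℝ) ^ (p + 1))⁻¹) ^ (kappa * θ) := by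
        rw [Real.rpow_add (by norm_num), Real.rpow_neg (by norm_num), Real.inv_rpow (by positivity),
          Real.rpow_mul (by norm_num)]
        norm_num
        norm_cast
      _ ≤ 9 * |codePoint (c s) - codePoint (c t)| ^ (kappa * θ) := by gcongr
      _ = _ := by norm_num
  refine le_dimH_range_of_holder (Real.toNNReal_pos.2 hκθ) hholder ?_
  intro z hz
  obtain ⟨s, -, hs⟩ := Real.ofDigits_SurjOn (by norm_num : 1 < 2) hz
  exact ⟨s, hs⟩

/-! ### The upper bound for the dimension -/

/-- A convergent sum of powers of diameters bounds the dimension of a limsup set, which is covered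
by each tail of the family. -/
lemma dimH_limsup_le {X ι : Type*} [EMetricSpace X] [Countable ι] {A : ι → Set X} {s : ℝ≥0}
    (hs : 0 < s) (h : ∑' i, ediam (A i) ^ (s : ℝ) ≠ ∞) :
    dimH {ξ | {i | ξ ∈ A i}.Infinite} ≤ s := by
  borelize X
  have hs' : (0 : ℝ) < s := by exact_mod_cast hs
  have htend := ENNReal.tendsto_tsum_compl_atTop_zero h
  refine dimH_le_of_hausdorffMeasure_ne_top (ne_of_lt ?_)
  set r : Finset ι → ℝ≥0∞ := fun T => (∑' i : { i // i ∉ T }, ediam (A i) ^ (s : ℝ)) ^ (s : ℝ)⁻¹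
  have hr : Tendsto r atTop (𝓝 0) := by
    have := (ENNReal.continuous_rpow_const (y := (s : ℝ)⁻¹)).tendsto 0
    rw [ENNReal.zero_rpow_of_pos (inv_pos.2 hs')] at this
    exact this.comp htend
  have hle := Measure.hausdorffMeasure_le_liminf_tsum (s : ℝ) {ξ | {i | ξ ∈ A i}.Infinite} r hr
    (fun (T : Finset ι) (i : { i // i ∉ T }) => A i) ?_ ?_
  · rw [htend.liminf_eq] at hle
    exact hle.trans_lt (by simp)
  · refine Eventually.of_forall fun T i => ?_
    rw [ENNReal.le_rpow_inv_iff hs']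
    exact ENNReal.le_tsum (f := fun i : { i // i ∉ T } => ediam (A i) ^ (s : ℝ)) i
  · refine Eventually.of_forall fun T ξ hξ => ?_
    obtain ⟨i, hi, hiT⟩ := (show {i | ξ ∈ A i}.Infinite from hξ).exists_notMem_finset T
    exact mem_iUnion.2 ⟨⟨i, hiT⟩, hi⟩

lemma tsum_indicator_den_rpow_ne_top {S : Set ReducedPair} {b t C : ℝ} (ht : 0 ≤ t) (hbt : b < t)
    (hS : ∀ᶠ j : ℕ in atTop, ((S ∩ block j).ncard : ℝ) ≤ C * 3 ^ (b * j)) :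
    ∑' x : ReducedPair, S.indicator (fun x => ENNReal.ofReal ((x.den : ℝ) ^ (-t))) x ≠ ∞ := by
  set f : ReducedPair → ℝ≥0∞ := fun x => ENNReal.ofReal ((x.den : ℝ) ^ (-t)) with hf
  have hfib : ∀ j : ℕ, (fun x : ReducedPair => Nat.log 3 x.den) ⁻¹' {j} = block j := by
    intro j
    ext x
    rw [mem_preimage, mem_singleton_iff,
      Nat.log_eq_iff (Or.inr ⟨by norm_num, x.den_pos.ne'⟩)]
    rfl
  have hsummable : Summable fun j : ℕ => ((S ∩ block j).ncard : ℝ) * 3 ^ (-(t * j)) := by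
    have hgeo : Summable fun j : ℕ => C * ((3 : ℝ) ^ (b - t)) ^ j :=
      (summable_geometric_of_lt_one (by positivity)
        (Real.rpow_lt_one_of_one_lt_of_neg (by norm_num) (by linarith))).mul_left C
    refine Summable.of_norm_bounded_eventually_nat hgeo ?_
    filter_upwards [hS] with j hj
    rw [Real.norm_of_nonneg (by positivity)]
    calc _ ≤ C * 3 ^ (b * j) * 3 ^ (-(t * j)) := by gcongr
      _ = _ := by
        rw [mul_assoc, ← Real.rpow_add (by norm_num), ← Real.rpow_natCast,
          ← Real.rpow_mul (by norm_num)]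
        congr 2
        ring
  rw [← ENNReal.tsum_fiberwise _ fun x : ReducedPair => Nat.log 3 x.den]
  refine ne_top_of_le_ne_top hsummable.tsum_ofReal_ne_top (ENNReal.tsum_le_tsum fun j => ?_)
  rw [hfib, tsum_subtype, indicator_indicator, inter_comm, ← tsum_subtype]
  calc ∑' x : ↥(S ∩ block j), f x
      ≤ ∑' _x : ↥(S ∩ block j), ENNReal.ofReal (3 ^ (-(t * j))) := by
        refine ENNReal.tsum_le_tsum fun x => ENNReal.ofReal_le_ofReal ?_
        have h3 : (3 : ℝ) ^ (j : ℝ) ≤ x.1.den := by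
          rw [Real.rpow_natCast]
          exact_mod_cast x.2.2.1
        rw [mul_comm t, ← mul_neg, Real.rpow_mul (by norm_num)]
        exact Real.rpow_le_rpow_of_nonpos (by positivity) h3 (by linarith)
    _ = _ := by
        have hfin := (finite_block j).inter_of_right S
        rw [ENNReal.tsum_set_const, ← hfin.cast_ncard_eq, ENNReal.ofReal_mul (by positivity),
          ENNReal.ofReal_natCast]
        rfl

lemma ncard_block_le (j : ℕ) : ((block j).ncard : ℝ) ≤ 9 * 3 ^ (2 * (j : ℝ)) := by
  have h1 : (block j).ncard ≤ 3 ^ (j + 1) * 3 ^ (j + 1) := by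
    rw [← Set.ncard_image_of_injective (block j) (Subtype.val_injective :
      Function.Injective (Subtype.val : ReducedPair → ℕ × ℕ))]
    have hsub : Subtype.val '' block j ⊆
        ((Finset.range (3 ^ (j + 1)) ×ˢ Finset.range (3 ^ (j + 1)) : Finset (ℕ × ℕ)) :
          Set (ℕ × ℕ)) := by
      rintro _ ⟨x, hx, rfl⟩
      simpa using ⟨x.2.1.trans hx.2, hx.2⟩
    refine (Set.ncard_le_ncard hsub (Finset.finite_toSet _)).trans ?_
    rw [Set.ncard_coe_finset, Finset.card_product, Finset.card_range]
  have h2 : (9 : ℝ) * 3 ^ (2 * (j : ℝ)) = 3 ^ (j + 1) * 3 ^ (j + 1) := by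
    rw [Real.rpow_mul (by norm_num), Real.rpow_natCast, pow_succ]
    norm_num
    rw [show (9 : ℝ) = 3 * 3 by norm_num, mul_pow]
    ring
  rw [h2]
  exact_mod_cast h1

section Probability

variable {Ω : Type*} [MeasurableSpace Ω] {P : Measure Ω} [IsProbabilityMeasure P]
  {PK : Set ReducedPair} {Y : ReducedPair → Ω → UnitAddCircle}

/-- The balls `B (Y x, q ^ (-μ))` that meet the Cantor set have a finite expected sum of `s`-th
powers of radii. A ball with a centre outside of the Cantor set meets it with probability at most
`8 q ^ (-μ (1 - κ))`. -/
lemma ae_tsum_ne_top (hPK : density PK = (kappa : EReal)) (hY : IsRandomModel P PK Y) {μ s : ℝ}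
    (hμ : 0 < μ) (hs : 0 < s) (h1 : kappa < μ * s) (h2 : 2 < μ * (s + 1 - kappa)) :
    ∀ᵐ ω ∂P, ∑' x : ReducedPair,
      {ω | x ∈ PK ∨ Y x ω ∈ thickening ((x.den : ℝ) ^ (-μ)) cantorCircle}.indicator
        (fun _ => ENNReal.ofReal ((x.den : ℝ) ^ (-(μ * s)))) ω ≠ ∞ := by
  set B : ReducedPair → Set Ω :=
    fun x => {ω | x ∈ PK ∨ Y x ω ∈ thickening ((x.den : ℝ) ^ (-μ)) cantorCircle} with hB
  have hBm : ∀ x, MeasurableSet (B x) := fun x =>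
    (MeasurableSet.const _).union (hY.measurable x isOpen_thickening.measurableSet)
  have hmeas : ∀ x : ReducedPair, Measurable
      ((B x).indicator fun _ => ENNReal.ofReal ((x.den : ℝ) ^ (-(μ * s)))) :=
    fun x => measurable_const.indicator (hBm x)
  have hfin : ∫⁻ ω, ∑' x : ReducedPair,
      (B x).indicator (fun _ => ENNReal.ofReal ((x.den : ℝ) ^ (-(μ * s)))) ω ∂P ≠ ∞ := by
    rw [lintegral_tsum fun x => (hmeas x).aemeasurable]
    obtain ⟨b, hb1, hb2⟩ := exists_between h1
    have hsum1 := tsum_indicator_den_rpow_ne_top (S := PK) (b := b) (t := μ * s) (C := 1)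
      (by positivity) hb2 (by
        simpa using eventually_ncard_le (S := PK) (b := b)
          (by rw [hPK]; exact EReal.coe_lt_coe_iff.2 hb1))
    have hsum2 := tsum_indicator_den_rpow_ne_top (S := univ) (b := 2)
      (t := μ * (s + 1 - kappa)) (C := 9) (by linarith) h2 (by
        simpa only [univ_inter] using Eventually.of_forall ncard_block_le)
    refine ne_top_of_le_ne_top (ENNReal.add_ne_top.2 ⟨hsum1, ENNReal.mul_ne_top
      (ENNReal.ofReal_ne_top (r := 8)) hsum2⟩) ?_
    rw [← ENNReal.tsum_mul_left, ← ENNReal.tsum_add]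
    refine ENNReal.tsum_le_tsum fun x => ?_
    rw [lintegral_indicator_const (hBm x)]
    by_cases hx : x ∈ PK
    · rw [indicator_of_mem hx]
      exact (mul_le_of_le_one_right' prob_le_one).trans le_self_add
    · rw [indicator_of_notMem hx, zero_add, indicator_of_mem (mem_univ x)]
      have hq0 : (0 : ℝ) < x.den := Nat.cast_pos.2 x.den_pos
      have hq1 : (1 : ℝ) ≤ x.den := Nat.one_le_cast.2 x.den_pos
      have hBx : P (B x) ≤ ENNReal.ofReal (8 * ((x.den : ℝ) ^ (-μ)) ^ (1 - kappa)) := by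
        have : B x = Y x ⁻¹' thickening ((x.den : ℝ) ^ (-μ)) cantorCircle := by
          ext ω
          simp [hB, hx]
        rw [this, ← Measure.map_apply (hY.measurable x) isOpen_thickening.measurableSet,
          hY.law_circle x hx]
        exact volume_thickening_cantorCircle_le (by positivity)
          (Real.rpow_le_one_of_one_le_of_nonpos hq1 (by linarith))
      refine (mul_le_mul_right hBx _).trans (le_of_eq ?_)
      rw [← ENNReal.ofReal_mul (by positivity), ← ENNReal.ofReal_mul (by norm_num),
        ← Real.rpow_mul hq0.le, mul_left_comm, ← Real.rpow_add hq0]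
      congr 3
      ring
  filter_upwards [ae_lt_top (Measurable.tsum fun x => hmeas x) hfin] with ω hω
  exact hω.ne

theorem ae_dimH_approxSet_inter_le (hPK : density PK = (kappa : EReal))
    (hY : IsRandomModel P PK Y) {μ s : ℝ} (hμ : 0 < μ) (hs : 0 < s) (h1 : kappa < μ * s)
    (h2 : 2 < μ * (s + 1 - kappa)) :
    ∀ᵐ ω ∂P, dimH (approxSet (fun x => Y x ω) μ ∩ cantorCircle) ≤ ENNReal.ofReal s := by
  classical
  filter_upwards [ae_tsum_ne_top hPK hY hμ hs h1 h2] with ω hω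
  set A : ReducedPair → Set UnitAddCircle := fun x =>
    if x ∈ PK ∨ Y x ω ∈ thickening ((x.den : ℝ) ^ (-μ)) cantorCircle
    then ball (Y x ω) ((x.den : ℝ) ^ (-μ)) else ∅ with hA
  have hsub : approxSet (fun x => Y x ω) μ ∩ cantorCircle ⊆ {ξ | {x | ξ ∈ A x}.Infinite} := by
    rintro ξ ⟨hξ, hξK⟩
    refine Set.Infinite.mono (fun x hx => ?_) hξ
    have hx' : dist ξ (Y x ω) < (x.den : ℝ) ^ (-μ) := hx
    have hthick : Y x ω ∈ thickening ((x.den : ℝ) ^ (-μ)) cantorCircle :=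
      mem_thickening_iff.2 ⟨ξ, hξK, by rwa [dist_comm]⟩
    simpa [hA, hthick] using hx'
  refine (dimH_mono hsub).trans (dimH_limsup_le (Real.toNNReal_pos.2 hs) ?_)
  rw [Real.coe_toNNReal s hs.le]
  refine ne_top_of_le_ne_top (ENNReal.mul_ne_top (ENNReal.ofReal_ne_top (r := 2 ^ s)) hω) ?_
  rw [← ENNReal.tsum_mul_left]
  refine ENNReal.tsum_le_tsum fun x => ?_
  by_cases hx : x ∈ PK ∨ Y x ω ∈ thickening ((x.den : ℝ) ^ (-μ)) cantorCircle
  · have hq0 : (0 : ℝ) < x.den := Nat.cast_pos.2 x.den_pos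
    have hd : ediam (ball (Y x ω) ((x.den : ℝ) ^ (-μ))) ≤
        ENNReal.ofReal (2 * (x.den : ℝ) ^ (-μ)) := by
      rw [← eball_ofReal, ENNReal.ofReal_mul (by norm_num)]
      simpa using ediam_eball_le (x := Y x ω) (r := ENNReal.ofReal ((x.den : ℝ) ^ (-μ)))
    have hxω : ω ∈ {ω | x ∈ PK ∨ Y x ω ∈ thickening ((x.den : ℝ) ^ (-μ)) cantorCircle} := hx
    rw [indicator_of_mem hxω]
    simp only [hA, hx, if_true]
    refine (ENNReal.rpow_le_rpow hd hs.le).trans (le_of_eq ?_)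
    rw [ENNReal.ofReal_rpow_of_nonneg (by positivity) hs.le, ← ENNReal.ofReal_mul (by positivity),
      Real.mul_rpow (by norm_num) (by positivity), ← Real.rpow_mul hq0.le, neg_mul]
  · simp only [hA, hx, if_false, ediam_empty]
    rw [ENNReal.zero_rpow_of_pos hs]
    exact bot_le

end Probability

/-! ### Exponents of approximation -/

lemma approxSet_antitone (y : ReducedPair → UnitAddCircle) {μ ν : ℝ} (h : μ ≤ ν) :
    approxSet y ν ⊆ approxSet y μ := by
  intro ξ hξ
  refine Set.Infinite.mono (fun x hx => ?_) hξ
  refine lt_of_lt_of_le (show dist ξ (y x) < (x.den : ℝ) ^ (-ν) from hx) ?_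
  exact Real.rpow_le_rpow_of_exponent_le (Nat.one_le_cast.2 x.den_pos) (by linarith)

lemma le_exponent_of_mem {y : ReducedPair → UnitAddCircle} {μ : ℝ} {ξ : UnitAddCircle}
    (hμ : 0 ≤ μ) (h : ξ ∈ approxSet y μ) : (μ : EReal) ≤ exponent y ξ :=
  le_sSup ⟨μ, ⟨hμ, h⟩, rfl⟩

lemma approxSet_subset_exponentSet (y : ReducedPair → UnitAddCircle) {μ ν : ℝ} (hμ : 0 ≤ μ)
    (h : μ ≤ ν) : approxSet y ν ⊆ exponentSet y μ :=
  fun _ hξ => le_exponent_of_mem hμ (approxSet_antitone y h hξ)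

lemma exponentSet_subset_approxSet (y : ReducedPair → UnitAddCircle) {μ ν : ℝ} (h : ν < μ) :
    exponentSet y μ ⊆ approxSet y ν := by
  intro ξ hξ
  have h1 : (ν : EReal) < exponent y ξ := (EReal.coe_lt_coe_iff.2 h).trans_le hξ
  obtain ⟨_, ⟨t, ht, rfl⟩, hνt⟩ := lt_sSup_iff.1 h1
  exact approxSet_antitone y (EReal.coe_lt_coe_iff.1 hνt).le ht.2

section Probability

variable {Ω : Type*} [MeasurableSpace Ω] {P : Measure Ω} [IsProbabilityMeasure P]
  {PK : Set ReducedPair} {Y : ReducedPair → Ω → UnitAddCircle}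

/-- For `μ < 2` even every single basic interval of level `≈ μ j` contains a point of the `j`-th
block. -/
lemma ae_cantorCircle_subset_approxSet (hPK : density PK = (kappa : EReal))
    (hY : IsRandomModel P PK Y) {μ : ℝ} (hμ : 0 < μ) (hμ2 : μ < 2) :
    ∀ᵐ ω ∂P, cantorCircle ⊆ approxSet (fun x => Y x ω) μ := by
  have h := ae_eventually_hits_sdiff hPK hY (θ := 1) zero_le_one le_rfl hμ (by linarith)
  filter_upwards [h] with ω hω
  rw [cantorCircle_eq_range]
  rintro _ ⟨b, rfl⟩
  obtain ⟨N, hN⟩ := eventually_atTop.1 hω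
  choose x hx hxb using fun j : ℕ => hN (j + N) (by omega) b
  refine Set.infinite_of_injective_forall_mem (f := x) ?_ fun j => ?_
  · intro k l hkl
    have h1 := hx k
    rw [hkl] at h1
    have := eq_of_mem_block h1 (hx l)
    omega
  · have h1 := hxb j
    rw [one_mul, Nat.floor_natCast] at h1
    obtain ⟨v, hv, hxv⟩ := mem_iUnion₂.1 h1
    rw [arc_congr hv] at hxv
    exact dist_lt_of_mem_arc hμ (Nat.le_ceil _) (hx j) (codePoint_mem_arc b _) hxv

/-- Hits with a ratio `η` slightly larger than `θ` leave room, at large scales, for the gap in front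
of a window that `le_dimH_approxSet_inter` requires, and for the rounding of `η m`. -/
lemma le_dimH_of_frequently_hits {y : ReducedPair → UnitAddCircle} {μ θ η : ℝ} (hμ : 1 ≤ μ)
    (hθ : 0 < θ) (hθη : θ < η) (hη : η ≤ 1)
    (h : ∃ᶠ j : ℕ in atTop,
      Hits y (block j) ⌊η * ⌈μ * (j + 1)⌉₊⌋₊ ⌈μ * (j + 1)⌉₊) :
    ENNReal.ofReal (kappa * θ) ≤ dimH (approxSet y μ ∩ cantorCircle) := by
  refine le_dimH_approxSet_inter hμ hθ (hθη.le.trans hη) fun M => ?_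
  obtain ⟨j, hj, hhit⟩ := frequently_atTop.1 h (max M ⌈((M : ℝ) + 1) / (η - θ)⌉₊)
  set m := ⌈μ * (j + 1)⌉₊ with hm
  have hmj : μ * (j + 1) ≤ m := Nat.le_ceil _
  have hη0 : 0 ≤ η := (hθ.trans hθη).le
  refine ⟨j, ⌊η * m⌋₊, m, (le_max_left _ _).trans hj, ?_, ?_, hmj, hhit⟩
  · have h1 : (⌊η * m⌋₊ : ℝ) ≤ m := (Nat.floor_le (by positivity)).trans
      (mul_le_of_le_one_left (Nat.cast_nonneg m) hη)
    exact_mod_cast h1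
  · have h1 : ((M : ℝ) + 1) / (η - θ) ≤ j :=
      (Nat.le_ceil _).trans (by exact_mod_cast (le_max_right _ _).trans hj)
    rw [div_le_iff₀ (by linarith)] at h1
    have h2 : (j : ℝ) ≤ m := by nlinarith [(Nat.cast_nonneg j : (0 : ℝ) ≤ _)]
    have h3 := Nat.lt_floor_add_one (η * m)
    nlinarith

lemma ae_le_dimH_approxSet_inter (hPK : density PK = (kappa : EReal)) (hY : IsRandomModel P PK Y)
    {μ θ : ℝ} (hμ : 1 ≤ μ) (hθ0 : 0 < θ) (hθ1 : θ < 1)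
    (hθ : θ * μ < 1 ∨ (kappa * θ + (1 - kappa)) * μ < 2) :
    ∀ᵐ ω ∂P, ENNReal.ofReal (kappa * θ) ≤
      dimH (approxSet (fun x => Y x ω) μ ∩ cantorCircle) := by
  have hμ0 : 0 < μ := by linarith
  rcases hθ with hθ | hθ
  · obtain ⟨η, h1, h2⟩ := exists_between (lt_min hθ1 ((lt_div_iff₀ hμ0).2 hθ))
    have h3 := (lt_min_iff.1 h2).1.le
    have h4 := (lt_div_iff₀ hμ0).1 (lt_min_iff.1 h2).2
    filter_upwards [ae_frequently_hits hPK hY (hθ0.trans h1).le h3 hμ0 h4] with ω hω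
    exact le_dimH_of_frequently_hits hμ hθ0 h1 h3 hω
  · have hθ' : θ < (2 / μ - (1 - kappa)) / kappa := by
      rw [lt_div_iff₀ kappa_pos, lt_sub_iff_add_lt, lt_div_iff₀ hμ0, mul_comm θ]
      exact hθ
    obtain ⟨η, h1, h2⟩ := exists_between (lt_min hθ1 hθ')
    have h3 := (lt_min_iff.1 h2).1.le
    have h4 : (kappa * η + (1 - kappa)) * μ < 2 := by
      have := (lt_min_iff.1 h2).2
      rwa [lt_div_iff₀ kappa_pos, lt_sub_iff_add_lt, lt_div_iff₀ hμ0, mul_comm η] at this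
    filter_upwards [ae_eventually_hits_sdiff hPK hY (hθ0.trans h1).le h3 hμ0 h4] with ω hω
    exact le_dimH_of_frequently_hits hμ hθ0 h1 h3 hω.frequently

end Probability

lemma ennreal_le_of_forall_rat_gt {z : ℝ≥0∞} {a : ℝ}
    (h : ∀ s : ℚ, a < s → z ≤ ENNReal.ofReal s) : z ≤ ENNReal.ofReal a := by
  by_contra! hlt
  obtain ⟨s, hs0, h1, h2⟩ := ENNReal.lt_iff_exists_rat_btwn.1 hlt
  have h3 : a < s := by
    have := (ENNReal.ofReal_lt_ofReal_iff' (p := a) (q := (s : ℝ))).1 h1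
    exact this.1
  exact (h2.trans_le (h s h3)).false

end CantorApprox

end

open CantorApprox

theorem mainTheorem1 {Ω : Type*} [MeasurableSpace Ω] (P : Measure Ω) [IsProbabilityMeasure P]
    (PK : Set CantorApprox.ReducedPair)
    (hPK : CantorApprox.density PK = (CantorApprox.kappa : EReal))
    (Y : CantorApprox.ReducedPair → Ω → UnitAddCircle)
    (hY : CantorApprox.IsRandomModel P PK Y) :
    ∀ᵐ ω ∂P,
      (∀ ξ ∈ CantorApprox.cantorCircle, 2 ≤ CantorApprox.exponent (fun x => Y x ω) ξ) ∧
      ∀ μ : ℝ, 2 ≤ μ →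
        dimH (CantorApprox.exponentSet (fun x => Y x ω) μ ∩ CantorApprox.cantorCircle) =
          ENNReal.ofReal (max (2 / μ + CantorApprox.kappa - 1) (CantorApprox.kappa / μ)) := by
  -- rational parameters suffice, so that countably many almost sure statements have to be combined
  have hdirichlet : ∀ᵐ ω ∂P, ∀ ν : ℚ, 0 < (ν : ℝ) → (ν : ℝ) < 2 →
      cantorCircle ⊆ approxSet (fun x => Y x ω) ν := by
    refine ae_all_iff.2 fun ν => ?_
    by_cases h : 0 < (ν : ℝ) ∧ (ν : ℝ) < 2
    · filter_upwards [ae_cantorCircle_subset_approxSet hPK hY h.1 h.2] with ω hω _ _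
      exact hω
    · exact Eventually.of_forall fun ω h1 h2 => absurd ⟨h1, h2⟩ h
  have hupper : ∀ᵐ ω ∂P, ∀ ν s : ℚ, 0 < (ν : ℝ) → 0 < (s : ℝ) → kappa < ν * s →
      2 < (ν : ℝ) * (s + 1 - kappa) →
      dimH (approxSet (fun x => Y x ω) ν ∩ cantorCircle) ≤ ENNReal.ofReal s := by
    refine ae_all_iff.2 fun ν => ae_all_iff.2 fun s => ?_
    by_cases h : 0 < (ν : ℝ) ∧ 0 < (s : ℝ) ∧ kappa < ν * s ∧ 2 < (ν : ℝ) * (s + 1 - kappa)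
    · filter_upwards [ae_dimH_approxSet_inter_le hPK hY h.1 h.2.1 h.2.2.1 h.2.2.2]
        with ω hω _ _ _ _
      exact hω
    · exact Eventually.of_forall fun ω h1 h2 h3 h4 => absurd ⟨h1, h2, h3, h4⟩ h
  have hlower : ∀ᵐ ω ∂P, ∀ ν θ : ℚ, 1 ≤ (ν : ℝ) → 0 < (θ : ℝ) → (θ : ℝ) < 1 →
      ((θ : ℝ) * ν < 1 ∨ (kappa * θ + (1 - kappa)) * ν < 2) →
      ENNReal.ofReal (kappa * θ) ≤ dimH (approxSet (fun x => Y x ω) ν ∩ cantorCircle) := by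
    refine ae_all_iff.2 fun ν => ae_all_iff.2 fun θ => ?_
    by_cases h : 1 ≤ (ν : ℝ) ∧ 0 < (θ : ℝ) ∧ (θ : ℝ) < 1 ∧
        ((θ : ℝ) * ν < 1 ∨ (kappa * θ + (1 - kappa)) * ν < 2)
    · filter_upwards [ae_le_dimH_approxSet_inter hPK hY h.1 h.2.1 h.2.2.1 h.2.2.2]
        with ω hω _ _ _ _
      exact hω
    · exact Eventually.of_forall fun ω h1 h2 h3 h4 => absurd ⟨h1, h2, h3, h4⟩ h
  filter_upwards [hdirichlet, hupper, hlower] with ω hd hu hl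
  have hκ0 := kappa_pos
  have hκ1 := kappa_lt_one
  refine ⟨fun ξ hξ => ?_, fun μ hμ => ?_⟩
  · refine le_of_forall_lt fun c hc => ?_
    obtain ⟨ν, hν1, hν2⟩ := EReal.lt_iff_exists_rat_btwn.1 (max_lt hc (zero_lt_two' EReal))
    have h0 : (0 : ℝ) < ν := by exact_mod_cast (le_max_right _ _).trans_lt hν1
    have h2 : (ν : ℝ) < 2 := EReal.coe_lt_coe_iff.1 hν2
    exact ((le_max_left _ _).trans_lt hν1).trans_le
      (le_exponent_of_mem h0.le (hd ν h0 h2 hξ))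
  have hμ0 : 0 < μ := by linarith
  have hpos : 0 < max (2 / μ + kappa - 1) (kappa / μ) := lt_max_of_lt_right (by positivity)
  refine le_antisymm ?_ ?_
  · refine ennreal_le_of_forall_rat_gt fun s hs => ?_
    have hs0 : (0 : ℝ) < s := hpos.trans hs
    obtain ⟨hs1, hs2⟩ := max_lt_iff.1 hs
    have hs3 : (0 : ℝ) < s + 1 - kappa := by linarith
    have h1 : kappa / s < μ := by
      rw [div_lt_iff₀ hμ0] at hs2
      rw [div_lt_iff₀ hs0, mul_comm]
      exact hs2
    have h2 : 2 / (s + 1 - kappa) < μ := by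
      rw [div_lt_iff₀ hs3, mul_comm, ← div_lt_iff₀ hμ0]
      linarith
    obtain ⟨ν, hν1, hν2⟩ := exists_rat_btwn (max_lt h1 h2)
    obtain ⟨hν3, hν4⟩ := max_lt_iff.1 hν1
    refine (dimH_mono (Set.inter_subset_inter_left _
      (exponentSet_subset_approxSet _ hν2))).trans (hu ν s ((by positivity : 0 < kappa / s).trans hν3)
        hs0 ((div_lt_iff₀ hs0).1 hν3) ((div_lt_iff₀ hs3).1 hν4))
  · refine le_of_forall_lt fun c hc => ?_
    obtain ⟨t, ht0, hct, ht⟩ := ENNReal.lt_iff_exists_rat_btwn.1 hc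
    have ht' : (t : ℝ) < max (2 / μ + kappa - 1) (kappa / μ) :=
      ((ENNReal.ofReal_lt_ofReal_iff' (p := (t : ℝ))).1 ht).1
    have ht0' : (0 : ℝ) ≤ t := by exact_mod_cast ht0
    have hdiv : (0 : ℝ) ≤ t / kappa := by positivity
    have h2μ : 2 / μ ≤ 1 := (div_le_one hμ0).2 hμ
    obtain ⟨ν, θ, hνμ, htθ, hθ1, hor⟩ : ∃ ν θ : ℚ, μ < (ν : ℝ) ∧ (t : ℝ) / kappa < θ ∧
        (θ : ℝ) < 1 ∧ ((θ : ℝ) * ν < 1 ∨ (kappa * θ + (1 - kappa)) * ν < 2) := by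
      rcases lt_max_iff.1 ht' with h | h
      · have h1 : (t : ℝ) / kappa < (2 / μ + kappa - 1) / kappa := by gcongr
        obtain ⟨θ, hθ1, hθ2⟩ := exists_rat_btwn h1
        have hθ0 : (0 : ℝ) < θ := hdiv.trans_lt hθ1
        have hD : 0 < kappa * θ + (1 - kappa) := by nlinarith [mul_pos hκ0 hθ0]
        have h3 : μ < 2 / (kappa * θ + (1 - kappa)) := by
          rw [lt_div_iff₀ hκ0] at hθ2
          rw [lt_div_iff₀ hD, mul_comm, ← lt_div_iff₀ hμ0]
          linarith
        obtain ⟨ν, hν1, hν2⟩ := exists_rat_btwn h3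
        refine ⟨ν, θ, hν1, hθ1, hθ2.trans_le ?_, Or.inr ?_⟩
        · rw [div_le_one hκ0]
          linarith
        · rw [lt_div_iff₀ hD] at hν2
          linarith
      · have h1 : (t : ℝ) / kappa < 1 / μ := by
          rw [div_lt_iff₀ hκ0, one_div_mul_eq_div]
          exact h
        obtain ⟨θ, hθ1, hθ2⟩ := exists_rat_btwn h1
        have hθ0 : (0 : ℝ) < θ := hdiv.trans_lt hθ1
        have h3 : μ < 1 / θ := by
          rw [lt_div_iff₀ hμ0] at hθ2
          rw [lt_div_iff₀ hθ0]
          linarith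
        obtain ⟨ν, hν1, hν2⟩ := exists_rat_btwn h3
        refine ⟨ν, θ, hν1, hθ1, hθ2.trans_le ?_, Or.inl ?_⟩
        · rw [div_le_one hμ0]
          linarith
        · rw [lt_div_iff₀ hθ0] at hν2
          linarith
    have hθ0 : (0 : ℝ) < θ := hdiv.trans_lt htθ
    have htκ : (t : ℝ) ≤ kappa * θ := by
      rw [div_lt_iff₀ hκ0] at htθ
      linarith
    refine hct.trans_le ((ENNReal.ofReal_le_ofReal htκ).trans
      ((hl ν θ (by linarith) hθ0 hθ1 hor).trans (dimH_mono ?_)))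
    exact Set.inter_subset_inter_left _ (approxSet_subset_exponentSet _ hμ0.le hνμ.le)
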